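/- Let $p$ be fixed and let $X, X_1, X_2, \ldots$ be i.i.d. random vectors in $\mathbb{R}^p$ with mean zero, finite fourth moments and covariance matrix $\Sigma=\Gamma\Lambda\Gamma^\top$, where $\Gamma=[\gamma_1,\ldots,\gamma_p]$ is orthogonal and $\Lambda=\mathrm{diag}(\lambda_1,\ldots,\lambda_p)$ with $\lambda_1>\cdots>\lambda_p$. Put $\beta=(\mathrm{diag}(\Lambda)^\top,\mathrm{vec}(\Gamma)^\top)^\top$ and $\Sigma_\beta=H^\top W H$, where $W=\mathrm{cov}\{\mathrm{vec}(XX^\top)\}$, $H=[\gamma_1\otimes\gamma_1,\ldots,\gamma_p\otimes\gamma_p,\gamma_1\otimes M_1,\ldots,\gamma_p\otimes M_p]$ and $M_j=(\lambda_j I_p-\Sigma)^+$ is the Moore–Penrose inverse. Sample covariance matrices are taken with divisor the sample size, and either are all centered at the sample mean or are all left uncentered (the mean being known to be $0$). Estimated eigenvectors and singular vectors may be any choice for which the estimators below are random vectors; as eigenvectors are determined only up to sign, the signs of the estimated eigenvectors are assumed to be such that, for each $j$, the inner product of $\gamma_j$ with its estimate is nonnegative with probability tending to $1$ as the sample size tends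 to infinity. 1. (PPCA) For even $n$, split $\{X_1,\ldots,X_n\}$ into two halves of size $n/2$ by a random split that is independent of the data, with sample covariance matrices $\widehat S_1,\widehat S_2$. Let $\widehat S_1^{1/2}\widehat S_2^{1/2}=\widehat U\widehat\Lambda\widehat V^\top$ be a singular value decomposition, with the singular values in descending order and $\widehat U=[\widehat u_1,\ldots,\widehat u_p]$, $\widehat V=[\widehat v_1,\ldots,\widehat v_p]$ orthogonal. Let $\widehat\Gamma=[\widehat\gamma_1,\ldots,\widehat\gamma_p]$, where $\widehat\gamma_j$ is a unit eigenvector of $\widehat u_j\widehat u_j^\top+\widehat v_j\widehat v_j^\top$ associated with its largest eigenvalue, and let $\widehat\beta=(\mathrm{diag}(\widehat\Lambda)^\top,\mathrm{vec}(\widehat\Gamma)^\top)^\top$. Then, as $n\to\infty$ through the even integers, $$\sqrt n(\widehat\beta-\beta)\stackrel{d}{\to}N(0_{p(p+1)},\Sigma_\beta).$$ 2. (PCA) Let $\widehat S=\widetilde\Gamma\widetilde\Lambda\widetilde\Gamma^\top$ be a spectral decomposition, with the eigenvalues in descending order and $\widetilde\Gamma$ orthogonal, of the sample covariance matrix $\widehat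 S$ of $X_1,\ldots,X_n$, and let $\widetilde\beta=(\mathrm{diag}(\widetilde\Lambda)^\top,\mathrm{vec}(\widetilde\Gamma)^\top)^\top$. Then, as $n\to\infty$, $$\sqrt n(\widetilde\beta-\beta)\stackrel{d}{\to}N(0_{p(p+1)},\Sigma_\beta).$$ -/

import Mathlib

open MeasureTheory ProbabilityTheory Filter Topology Matrix

noncomputable section

/-- The (symmetric, positive semidefinite) square root of a positive semidefinite matrix. -/
def psdSqrt {p : ℕ} (S : Matrix (Fin p) (Fin p) ℝ) : Matrix (Fin p) (Fin p) ℝ :=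
  cfc Real.sqrt S

/-- The Moore-Penrose inverse of a symmetric matrix: invert the nonzero eigenvalues and keep
the zero ones (here `0⁻¹ = 0`). The four Penrose equations are `symmPinv_penrose` below. -/
def symmPinv {p : ℕ} (A : Matrix (Fin p) (Fin p) ℝ) : Matrix (Fin p) (Fin p) ℝ :=
  cfc (fun x : ℝ => x⁻¹) A

/-- The covariance matrix of a random vector `Y` indexed by `ι`. -/
def covMat {Ω ι : Type*} [MeasurableSpace Ω] (P : Measure Ω) (Y : Ω → ι → ℝ) : Matrix ι ι ℝ :=
  Matrix.of fun a b => cov[fun ω => Y ω a, fun ω => Y ω b; P]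

/-- The sample covariance matrix, with divisor the sample size, of the observations `x i`,
`i ∈ s`. If `centered` is true the sample mean is subtracted; otherwise the observations are
used as they are (as one does when the mean is known to be zero). -/
def sampleCov {p : ℕ} (centered : Bool) (s : Finset ℕ) (x : ℕ → Fin p → ℝ) :
    Matrix (Fin p) (Fin p) ℝ :=
  let c : Fin p → ℝ := if centered then (s.card : ℝ)⁻¹ • ∑ i ∈ s, x i else 0
  (s.card : ℝ)⁻¹ • ∑ i ∈ s, vecMulVec (x i - c) (x i - c)

/-- `S = G diag(l) Gᵀ` is a spectral decomposition with `G` orthogonal (its columns are the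
eigenvectors) and the eigenvalues `l` in descending order. -/
structure IsSpectralDecomp {p : ℕ} (S : Matrix (Fin p) (Fin p) ℝ) (l : Fin p → ℝ)
    (G : Matrix (Fin p) (Fin p) ℝ) : Prop where
  orthogonal : G ∈ Matrix.orthogonalGroup (Fin p) ℝ
  antitone : Antitone l
  eq : S = G * diagonal l * Gᵀ

/-- `A = U diag(l) Vᵀ` is a singular value decomposition: `U`, `V` are orthogonal and the
singular values `l` are nonnegative, in descending order. -/
structure IsSVD {p : ℕ} (A U : Matrix (Fin p) (Fin p) ℝ) (l : Fin p → ℝ)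
    (V : Matrix (Fin p) (Fin p) ℝ) : Prop where
  orthogonal_left : U ∈ Matrix.orthogonalGroup (Fin p) ℝ
  orthogonal_right : V ∈ Matrix.orthogonalGroup (Fin p) ℝ
  nonneg : ∀ j, 0 ≤ l j
  antitone : Antitone l
  eq : A = U * diagonal l * Vᵀ

/-- `w` is a unit eigenvector of `A` associated with the largest eigenvalue of `A`. -/
def IsFirstEigenvector {p : ℕ} (A : Matrix (Fin p) (Fin p) ℝ) (w : Fin p → ℝ) : Prop :=
  w ⬝ᵥ w = 1 ∧ ∃ t : ℝ, A *ᵥ w = t • w ∧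
    ∀ r : ℝ, Module.End.HasEigenvalue (Matrix.toLin' A) r → r ≤ t

/-- `(l, G)` is an output of product-PCA on the two covariance matrices `S₁`, `S₂`: `l` are the
singular values of `S₁^{1/2} S₂^{1/2}`, and the `j`-th column of `G` is a first eigenvector of
`u_j u_jᵀ + v_j v_jᵀ`, with `u_j`, `v_j` the `j`-th left and right singular vectors. -/
def IsPPCA {p : ℕ} (S₁ S₂ : Matrix (Fin p) (Fin p) ℝ) (l : Fin p → ℝ)
    (G : Matrix (Fin p) (Fin p) ℝ) : Prop :=
  ∃ U V : Matrix (Fin p) (Fin p) ℝ, IsSVD (psdSqrt S₁ * psdSqrt S₂) U l V ∧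
    ∀ j, IsFirstEigenvector
      (vecMulVec (U.col j) (U.col j) + vecMulVec (V.col j) (V.col j)) (G.col j)

/-- The parameter vector `(diag(Λ)ᵀ, vec(Γ)ᵀ)ᵀ`; its coordinate `Sum.inr (j, k)` is the `k`-th
entry of the `j`-th column of `Γ`. -/
def betaVec {p : ℕ} (l : Fin p → ℝ) (G : Matrix (Fin p) (Fin p) ℝ) :
    EuclideanSpace ℝ (Fin p ⊕ Fin p × Fin p) :=
  WithLp.toLp 2 (Sum.elim l (vec G))

/-- `H = [γ₁ ⊗ γ₁, …, γ_p ⊗ γ_p, γ₁ ⊗ M₁, …, γ_p ⊗ M_p]`, a `p² × (p + p²)` matrix, where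
`γ_j` is the `j`-th column of `G` and `M_j = (l_j I - S)⁺`. The column `Sum.inr (j, k)` is the
`k`-th column of the block `γ_j ⊗ M_j`. -/
def matH {p : ℕ} (S : Matrix (Fin p) (Fin p) ℝ) (l : Fin p → ℝ)
    (G : Matrix (Fin p) (Fin p) ℝ) :
    Matrix (Fin p × Fin p) (Fin p ⊕ Fin p × Fin p) ℝ :=
  Matrix.fromCols
    (Matrix.of fun a j => G a.1 j * G a.2 j)
    (Matrix.of fun a jk => G a.1 jk.1 * symmPinv (l jk.1 • 1 - S) a.2 jk.2)

theorem symmPinv_penrose {p : ℕ} {A : Matrix (Fin p) (Fin p) ℝ} (hA : A.IsHermitian) :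
    A * symmPinv A * A = A ∧ symmPinv A * A * symmPinv A = symmPinv A ∧
      (A * symmPinv A).IsHermitian ∧ (symmPinv A * A).IsHermitian := by
  have hs : IsSelfAdjoint A := hA
  have hc (f : ℝ → ℝ) : ContinuousOn f (spectrum ℝ A) :=
    (Matrix.finite_real_spectrum (A := A)).continuousOn f
  have hid : cfc (fun x : ℝ => x) A = A := cfc_id' ℝ A
  have hB : IsSelfAdjoint (symmPinv A) := cfc_predicate (p := IsSelfAdjoint) _ A
  have h1 : A * symmPinv A = cfc (fun x : ℝ => x * x⁻¹) A := by
    rw [cfc_mul _ _ A (hc _) (hc _), hid, symmPinv]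
  have h2 : symmPinv A * A = cfc (fun x : ℝ => x⁻¹ * x) A := by
    rw [cfc_mul _ _ A (hc _) (hc _), hid, symmPinv]
  refine ⟨?_, ?_, ?_, ?_⟩
  · rw [h1]
    nth_rewrite 2 [← hid]
    rw [← cfc_mul _ _ A (hc _) (hc _)]
    have h : (fun x : ℝ => x * x⁻¹ * x) = fun x => x := funext fun x => mul_inv_mul_cancel x
    rw [h, hid]
  · rw [h2, symmPinv, ← cfc_mul _ _ A (hc _) (hc _)]
    have h : (fun x : ℝ => x⁻¹ * x * x⁻¹) = fun x => x⁻¹ := funext fun x => by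
      simpa using mul_inv_mul_cancel x⁻¹
    rw [h]
  · rw [h1]
    exact cfc_predicate (p := IsSelfAdjoint) _ A
  · rw [h2]
    exact cfc_predicate (p := IsSelfAdjoint) _ A

theorem psdSqrt_posSemidef {p : ℕ} (S : Matrix (Fin p) (Fin p) ℝ) :
    (psdSqrt S).PosSemidef := by
  open scoped MatrixOrder in
  exact Matrix.nonneg_iff_posSemidef.1 (cfc_nonneg fun x _ => Real.sqrt_nonneg x)

theorem psdSqrt_mul_self {p : ℕ} {S : Matrix (Fin p) (Fin p) ℝ} (hS : S.PosSemidef) :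
    psdSqrt S * psdSqrt S = S := by
  have hs : IsSelfAdjoint S := hS.isHermitian
  have hc (f : ℝ → ℝ) : ContinuousOn f (spectrum ℝ S) :=
    (Matrix.finite_real_spectrum (A := S)).continuousOn f
  rw [psdSqrt, ← cfc_mul _ _ S (hc _) (hc _)]
  have h : Set.EqOn (fun x : ℝ => √x * √x) (fun x => x) (spectrum ℝ S) := by
    intro x hx
    rw [hS.isHermitian.spectrum_real_eq_range_eigenvalues] at hx
    obtain ⟨i, rfl⟩ := hx
    exact Real.mul_self_sqrt (hS.eigenvalues_nonneg i)
  rw [cfc_congr h, cfc_id' ℝ S]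

end

/-! Since the eigenvalues of `Σ` are simple, `(Λ, Γ)` is, once signs are fixed, differentiable at
`Σ` with derivative `E ↦ Hᵀ vec E`: the eigenvalue `λ_j` moves by `γ_jᵀ E γ_j` and the vector `γ_j`
by `M_j E γ_j`. Both estimators have this same linear term, with `E` the error of the uncentered
covariance matrix of the whole sample, so the central limit theorem for `vec(XXᵀ)` gives both the
covariance `Hᵀ W H`.

For PPCA put `T_i = S_i^{1/2}`. Matched singular vectors satisfy `T₁T₂ v = l u` and `T₂T₁ u = l v`,
and the estimate is proportional to `u + v`; adding the equations, only the symmetric part of `T₁T₂`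
enters to first order. The identity `T₁T₂ + T₂T₁ = S₁ + S₂ - (T₁ - T₂)²` shows that this part is
`(S₁ + S₂)/2` up to a second order term (`ppca_expansion`; `spectralDecomp_expansion` for PCA; both
rest on `eigen_expansion`). All that is needed of the square root is a Lipschitz rate. A zero
eigenvalue would endanger it, but then `γ_jᵀX = 0` almost surely and the matching diagonal entries
of the rotated sample covariances vanish exactly (`ae_col_dotProduct_eq_zero`).

The expansions are deterministic and uniform (`pca_linearization`, `ppca_linearization`): the
remainder is at most `η ε` once the sampling error `ε` is below some `δ`. Chebyshev's inequality
gives `ε = O_p(n^{-1/2})` with a constant depending on the index set only through its size, hence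
also for an independent random split. Centering costs only `O(ε²)`. The remainder is therefore
`o_p(n^{-1/2})` (`tendsto_measure_of_linearization`), and Slutsky's theorem concludes. -/

open Asymptotics

/-! ### Rigidity of ordered spectral decompositions -/

/-- An antitone function on `Fin p` is determined by the multiset of its values. -/
theorem antitone_eq_of_multiset_map_eq {p : ℕ} {f g : Fin p → ℝ} (hf : Antitone f)
    (hg : Antitone g) (h : Finset.univ.val.map f = Finset.univ.val.map g) : f = g := by
  have hl (f : Fin p → ℝ) : ((List.ofFn f : List ℝ) : Multiset ℝ) = Finset.univ.val.map f := by
    rw [List.ofFn_eq_map]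
    rfl
  have hperm : (List.ofFn f).Perm (List.ofFn g) := by
    rw [← Multiset.coe_eq_coe, hl, hl, h]
  have := List.Perm.eq_of_pairwise' (r := (· ≥ ·))
    (List.pairwise_ofFn.2 fun i j hij => hf hij.le) (List.pairwise_ofFn.2 fun i j hij => hg hij.le)
    hperm
  exact List.ofFn_injective this

/-- Conjugate matrices share their characteristic polynomial, hence the multiset of its roots; the
common ordering fixes the enumeration. -/
theorem eigenvalues_eq_of_diagonal_eq_conj {p : ℕ} {lam l : Fin p → ℝ}
    {Q : Matrix (Fin p) (Fin p) ℝ} (hlam : Antitone lam) (hl : Antitone l)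
    (hQ : Qᵀ * Q = 1) (h : diagonal lam = Q * diagonal l * Qᵀ) : l = lam := by
  refine antitone_eq_of_multiset_map_eq hl hlam ?_
  have hc : (diagonal lam).charpoly = (diagonal l).charpoly := by
    rw [h, Matrix.charpoly_mul_comm, ← Matrix.mul_assoc, hQ, Matrix.one_mul]
  rw [charpoly_diagonal, charpoly_diagonal] at hc
  have hr (f : Fin p → ℝ) :
      (∏ i, (Polynomial.X - Polynomial.C (f i))).roots = Finset.univ.val.map f := by
    rw [← Polynomial.roots_multiset_prod_X_sub_C (Finset.univ.val.map f), Multiset.map_map]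
    rfl
  rw [← hr, ← hr, hc]

/-- `Q` commutes with `diagonal lam`, which entrywise reads `(lam i - lam j) * Q i j = 0`. -/
theorem offDiag_eq_zero_of_diagonal_eq_conj {p : ℕ} {lam : Fin p → ℝ}
    {Q : Matrix (Fin p) (Fin p) ℝ} (hlam : StrictAnti lam)
    (hQ : Qᵀ * Q = 1) (h : diagonal lam = Q * diagonal lam * Qᵀ) {i j : Fin p} (hij : i ≠ j) :
    Q i j = 0 := by
  have h1 : diagonal lam * Q = Q * diagonal lam := by
    rw [h, Matrix.mul_assoc, hQ, Matrix.mul_one, ← h]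
  have h2 := congrFun (congrFun h1 i) j
  rw [diagonal_mul, mul_diagonal] at h2
  have h3 : (lam i - lam j) * Q i j = 0 := by linarith
  exact (mul_eq_zero.1 h3).resolve_left (sub_ne_zero.2 (hlam.injective.ne hij))

/-! ### Convergence of spectral decompositions near a diagonal matrix -/

section Filter

variable {α : Type*} {p : ℕ} {L : Filter α}

theorem orthogonal_transpose_mul {Q : Matrix (Fin p) (Fin p) ℝ}
    (hQ : Q ∈ Matrix.orthogonalGroup (Fin p) ℝ) : Qᵀ * Q = 1 :=
  (Matrix.mem_orthogonalGroup_iff' (Fin p) ℝ).1 hQ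

theorem orthogonal_mul_transpose {Q : Matrix (Fin p) (Fin p) ℝ}
    (hQ : Q ∈ Matrix.orthogonalGroup (Fin p) ℝ) : Q * Qᵀ = 1 :=
  (Matrix.mem_orthogonalGroup_iff (Fin p) ℝ).1 hQ

theorem sum_sq_col_of_orthogonal {Q : Matrix (Fin p) (Fin p) ℝ}
    (hQ : Q ∈ Matrix.orthogonalGroup (Fin p) ℝ) (j : Fin p) : ∑ i, Q i j ^ 2 = 1 := by
  have := congrFun (congrFun (orthogonal_transpose_mul hQ) j) j
  rw [Matrix.mul_apply, Matrix.one_apply_eq] at this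
  simpa [sq] using this

theorem isCompact_entries_le_one :
    IsCompact {Q : Matrix (Fin p) (Fin p) ℝ | ∀ i j, Q i j ∈ Set.Icc (-1 : ℝ) 1} := by
  have := isCompact_univ_pi (ι := Fin p) (X := fun _ => Fin p → ℝ)
    (s := fun _ => Set.univ.pi fun _ => Set.Icc (-1 : ℝ) 1)
    fun i => isCompact_univ_pi fun j => isCompact_Icc
  have e : {Q : Fin p → Fin p → ℝ | ∀ i j, Q i j ∈ Set.Icc (-1 : ℝ) 1} =
      Set.univ.pi fun _ => Set.univ.pi fun _ => Set.Icc (-1 : ℝ) 1 := by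
    ext Q
    simp only [Set.mem_ofPred_eq, Set.mem_pi, Set.mem_univ, true_implies]
  change IsCompact {Q : Fin p → Fin p → ℝ | ∀ i j, Q i j ∈ Set.Icc (-1 : ℝ) 1}
  rwa [e]

/-- Spectral decompositions converge along any filter along which the matrices converge to a
diagonal matrix with distinct entries in descending order. -/
theorem spectralDecomp_tendsto {lam : Fin p → ℝ} (hlam : StrictAnti lam)
    {M Q : α → Matrix (Fin p) (Fin p) ℝ} {l : α → Fin p → ℝ}
    (hM : Tendsto M L (𝓝 (diagonal lam))) (h : ∀ᶠ a in L, IsSpectralDecomp (M a) (l a) (Q a)) :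
    (∀ j, Tendsto (fun a => l a j) L (𝓝 (lam j))) ∧
      ∀ i j, i ≠ j → Tendsto (fun a => Q a i j) L (𝓝 0) := by
  -- Along an ultrafilter the bounded family `Q` converges by compactness, so it is enough to
  -- identify the possible limits.
  suffices key : ∀ U : Ultrafilter α, (U : Filter α) ≤ L →
      (∀ j, Tendsto (fun a => l a j) U (𝓝 (lam j))) ∧
        ∀ i j, i ≠ j → Tendsto (fun a => Q a i j) U (𝓝 0) from
    ⟨fun j => (tendsto_iff_ultrafilter _ _ _).2 fun U hU => (key U hU).1 j,
      fun i j hij => (tendsto_iff_ultrafilter _ _ _).2 fun U hU => (key U hU).2 i j hij⟩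
  intro U hU
  have hM' := hM.mono_left hU
  have h' := h.filter_mono hU
  obtain ⟨Q', -, hQ'⟩ := (isCompact_entries_le_one (p := p)).ultrafilter_le_nhds (U.map Q) (by
    rw [le_principal_iff]
    refine h'.mono fun a ha i j => ?_
    have := sum_sq_col_of_orthogonal ha.orthogonal j
    have h1 : Q a i j ^ 2 ≤ 1 := by
      rw [← this]
      exact Finset.single_le_sum (f := fun i => Q a i j ^ 2) (fun _ _ => sq_nonneg _)
        (Finset.mem_univ i)
    exact abs_le.1 ((sq_le_one_iff_abs_le_one _).1 h1))
  have hQt : Tendsto Q U (𝓝 Q') := hQ'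
  have hQT : Tendsto (fun a => (Q a)ᵀ) U (𝓝 Q'ᵀ) :=
    (continuous_id.matrix_transpose.tendsto Q').comp hQt
  have hQQ : Q'ᵀ * Q' = 1 := by
    refine tendsto_nhds_unique (hQT.mul hQt) (tendsto_const_nhds.congr' ?_)
    exact h'.mono fun a ha => (orthogonal_transpose_mul ha.orthogonal).symm
  have hQQ2 : Q' * Q'ᵀ = 1 := mul_eq_one_comm.1 hQQ
  have hconj : Tendsto (fun a => (Q a)ᵀ * M a * Q a) U (𝓝 (Q'ᵀ * diagonal lam * Q')) :=
    (hQT.mul hM').mul hQt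
  have hdiag : ∀ᶠ a in (U : Filter α), (Q a)ᵀ * M a * Q a = diagonal (l a) := by
    refine h'.mono fun a ha => ?_
    have h1 := orthogonal_transpose_mul ha.orthogonal
    calc (Q a)ᵀ * M a * Q a = ((Q a)ᵀ * Q a) * diagonal (l a) * ((Q a)ᵀ * Q a) := by
          rw [ha.eq]; simp only [Matrix.mul_assoc]
      _ = diagonal (l a) := by rw [h1, Matrix.one_mul, Matrix.mul_one]
  set D := Q'ᵀ * diagonal lam * Q' with hD
  have hDt : Tendsto (fun a => diagonal (l a)) U (𝓝 D) := hconj.congr' hdiag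
  have hent (i j : Fin p) : Tendsto (fun a => diagonal (l a) i j) U (𝓝 (D i j)) :=
    ((continuous_id.matrix_elem i j).tendsto D).comp hDt
  have hl (j : Fin p) : Tendsto (fun a => l a j) U (𝓝 (D j j)) := by
    simpa using hent j j
  have hDd : D = diagonal fun j => D j j := by
    ext i j
    by_cases hij : i = j
    · subst hij; simp
    · rw [diagonal_apply_ne _ hij]
      refine tendsto_nhds_unique (hent i j) ?_
      simp [diagonal_apply_ne _ hij]
  have hanti : Antitone fun j => D j j := fun i j hij =>
    le_of_tendsto_of_tendsto (hl j) (hl i) (h'.mono fun a ha => ha.antitone hij)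
  -- The limit `D` is diagonal, ordered and conjugate to `diagonal lam`, hence equal to it; the
  -- limit `Q'` then commutes with `diagonal lam`.
  have hback : diagonal lam = Q' * diagonal (fun j => D j j) * Q'ᵀ := by
    rw [← hDd, hD]
    calc diagonal lam = (Q' * Q'ᵀ) * diagonal lam * (Q' * Q'ᵀ) := by
          rw [hQQ2, Matrix.one_mul, Matrix.mul_one]
      _ = _ := by simp only [Matrix.mul_assoc]
  have hDl := eigenvalues_eq_of_diagonal_eq_conj hlam.antitone hanti hQQ hback
  refine ⟨fun j => by simpa [← hDl] using hl j, fun i j hij => ?_⟩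
  rw [hDl] at hback
  rw [← offDiag_eq_zero_of_diagonal_eq_conj hlam hQQ hback hij]
  exact ((continuous_id.matrix_elem i j).tendsto Q').comp hQt

/-- Columns have unit length, so the diagonal carries all the mass that leaves the off-diagonal
entries. Its sign stays free until a convention is imposed. -/
theorem tendsto_sq_diag_of_offDiag {N : α → Matrix (Fin p) (Fin p) ℝ}
    (hcol : ∀ᶠ a in L, ∀ j, ∑ i, N a i j ^ 2 = 1)
    (hoff : ∀ i j, i ≠ j → Tendsto (fun a => N a i j) L (𝓝 0)) (j : Fin p) :
    Tendsto (fun a => N a j j ^ 2) L (𝓝 1) := by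
  have h1 : Tendsto (fun a => 1 - ∑ i ∈ Finset.univ.erase j, N a i j ^ 2) L
      (𝓝 (1 - ∑ i ∈ Finset.univ.erase j, (0 : ℝ) ^ 2)) :=
    tendsto_const_nhds.sub (tendsto_finsetSum _ fun i hi =>
      (hoff i j (Finset.ne_of_mem_erase hi)).pow 2)
  simp only [ne_eq, OfNat.ofNat_ne_zero, not_false_eq_true, zero_pow, Finset.sum_const_zero,
    sub_zero] at h1
  refine h1.congr' (hcol.mono fun a ha => ?_)
  rw [← ha j, ← Finset.add_sum_erase _ _ (Finset.mem_univ j)]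
  ring

theorem tendsto_diag_of_offDiag {N : α → Matrix (Fin p) (Fin p) ℝ}
    (hcol : ∀ᶠ a in L, ∀ j, ∑ i, N a i j ^ 2 = 1) (hpos : ∀ᶠ a in L, ∀ j, 0 ≤ N a j j)
    (hoff : ∀ i j, i ≠ j → Tendsto (fun a => N a i j) L (𝓝 0)) (j : Fin p) :
    Tendsto (fun a => N a j j) L (𝓝 1) := by
  have := (tendsto_sq_diag_of_offDiag hcol hoff j).sqrt
  rw [Real.sqrt_one] at this
  exact this.congr' (hpos.mono fun a ha => Real.sqrt_sq (ha j))

theorem tendsto_matrix_one {N : α → Matrix (Fin p) (Fin p) ℝ}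
    (hdiag : ∀ j, Tendsto (fun a => N a j j) L (𝓝 1))
    (hoff : ∀ i j, i ≠ j → Tendsto (fun a => N a i j) L (𝓝 0)) : Tendsto N L (𝓝 1) := by
  refine tendsto_pi_nhds.2 fun i => tendsto_pi_nhds.2 fun j => ?_
  by_cases hij : i = j
  · subst hij; simpa using hdiag i
  · rw [one_apply_ne hij]; exact hoff i j hij

theorem tendsto_entry {M : α → Matrix (Fin p) (Fin p) ℝ} {M' : Matrix (Fin p) (Fin p) ℝ}
    (h : Tendsto M L (𝓝 M')) (i j : Fin p) : Tendsto (fun a => M a i j) L (𝓝 (M' i j)) :=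
  ((continuous_id.matrix_elem i j).tendsto M').comp h

/-- Matrix of `O(e)` times a convergent matrix. -/
theorem isBigO_mul_entry {E N : α → Matrix (Fin p) (Fin p) ℝ} {N' : Matrix (Fin p) (Fin p) ℝ}
    {e : α → ℝ} (hE : ∀ i j, (fun a => E a i j) =O[L] e) (hN : Tendsto N L (𝓝 N'))
    (i j : Fin p) : (fun a => (E a * N a) i j) =O[L] e := by
  simp only [Matrix.mul_apply]
  refine IsBigO.fun_sum fun k _ => ?_
  simpa using (hE i k).mul ((tendsto_entry hN k j).isBigO_one ℝ)

theorem isBigO_entry_mul {E N : α → Matrix (Fin p) (Fin p) ℝ} {N' : Matrix (Fin p) (Fin p) ℝ}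
    {e : α → ℝ} (hE : ∀ i j, (fun a => E a i j) =O[L] e) (hN : Tendsto N L (𝓝 N'))
    (i j : Fin p) : (fun a => (N a * E a) i j) =O[L] e := by
  simp only [Matrix.mul_apply]
  refine IsBigO.fun_sum fun k _ => ?_
  simpa using ((tendsto_entry hN i k).isBigO_one ℝ).mul (hE k j)

/-- `E N = E N' + o(e)` when `E = O(e)` and `N → N'`. -/
theorem isLittleO_mul_sub_entry {E N : α → Matrix (Fin p) (Fin p) ℝ}
    {N' : Matrix (Fin p) (Fin p) ℝ}
    {e : α → ℝ} (hE : ∀ i j, (fun a => E a i j) =O[L] e) (hN : Tendsto N L (𝓝 N'))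
    (i j : Fin p) : (fun a => (E a * N a) i j - (E a * N') i j) =o[L] e := by
  simp only [Matrix.mul_apply, ← Finset.sum_sub_distrib, ← mul_sub]
  refine IsLittleO.fun_sum fun k _ => ?_
  have h0 : (fun a => N a k j - N' k j) =o[L] fun _ => (1 : ℝ) :=
    (isLittleO_one_iff ℝ).2 (by simpa using (tendsto_entry hN k j).sub_const (N' k j))
  simpa using (hE i k).mul_isLittleO h0

/-! ### Square roots near a diagonal matrix -/

/-- The entries of a symmetric square root of a matrix tending to `diagonal lam`, `lam`
nonnegative with distinct entries, tend to those of `diagonal √lam`. -/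
theorem sqrt_tendsto_diagonal {lam : Fin p → ℝ} (hinj : Function.Injective lam)
    {M T : α → Matrix (Fin p) (Fin p) ℝ}
    (hM : Tendsto M L (𝓝 (diagonal lam))) (hT : ∀ᶠ a in L, (T a).PosSemidef ∧ T a * T a = M a) :
    Tendsto T L (𝓝 (diagonal fun i => √(lam i))) := by
  have hsq : ∀ᶠ a in L, ∀ i, ∑ k, T a i k ^ 2 = M a i i := by
    refine hT.mono fun a ha i => ?_
    rw [← ha.2, Matrix.mul_apply]
    refine Finset.sum_congr rfl fun k _ => ?_
    have := ha.1.isHermitian.apply k i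
    simp only [star_trivial] at this
    rw [this, sq]
  -- Row `i` of `T` has squared length `M i i`, which converges; this bounds the entries.
  have hbdd (i j : Fin p) : (fun a => T a i j) =O[L] fun _ => (1 : ℝ) := by
    have h1 : (fun a => T a i j ^ 2) =O[L] fun _ => (1 : ℝ) := by
      refine IsBigO.trans (IsBigO.of_bound 1 ?_)
        ((tendsto_entry hM i i).isBigO_one ℝ)
      refine hsq.mono fun a ha => ?_
      rw [one_mul, Real.norm_of_nonneg (sq_nonneg _), ← ha i]
      exact (Finset.single_le_sum (f := fun k => T a i k ^ 2) (fun _ _ => sq_nonneg _)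
        (Finset.mem_univ j)).trans (le_abs_self _)
    have h2 : (fun a => T a i j ^ 2) =O[L] fun _ => (1 : ℝ) ^ 2 := by simpa using h1
    exact IsBigO.of_pow two_ne_zero h2
  have hzero : ∀ i j, (fun a => M a i j - diagonal lam i j) =o[L] fun _ => (1 : ℝ) := fun i j =>
    (isLittleO_one_iff ℝ).2 (by
      simpa using (tendsto_entry hM i j).sub_const (diagonal lam i j))
  -- `T` commutes with `M = T²`, so its commutator with `M - diagonal lam`, which is `o(1)`, has
  -- entries `(lam i - lam j) * T i j`.
  have hoff (i j : Fin p) (hij : i ≠ j) : Tendsto (fun a => T a i j) L (𝓝 0) := by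
    have h1 : (fun a => ∑ k, (T a i k * (M a k j - diagonal lam k j) -
        (M a i k - diagonal lam i k) * T a k j)) =o[L] fun _ => (1 : ℝ) := by
      refine IsLittleO.fun_sum fun k _ => IsLittleO.sub ?_ ?_
      · simpa using (hbdd i k).mul_isLittleO (hzero k j)
      · simpa using (hzero i k).mul_isBigO (hbdd k j)
    have h2 := (isLittleO_one_iff ℝ).1 h1
    have h3 := h2.const_mul (lam i - lam j)⁻¹
    rw [mul_zero] at h3
    refine h3.congr' (hT.mono fun a ha => ?_)
    have hc : T a * M a = M a * T a := by rw [← ha.2, Matrix.mul_assoc]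
    have e1 := congrFun (congrFun hc i) j
    rw [Matrix.mul_apply, Matrix.mul_apply] at e1
    have e2 := Matrix.mul_diagonal lam (T a) i j
    have e3 := Matrix.diagonal_mul lam (T a) i j
    rw [Matrix.mul_apply] at e2 e3
    simp only [mul_sub, sub_mul, Finset.sum_sub_distrib]
    rw [e1, e2, e3]
    have : lam i - lam j ≠ 0 := sub_ne_zero.2 (hinj.ne hij)
    field_simp
    ring
  refine tendsto_pi_nhds.2 fun i => tendsto_pi_nhds.2 fun j => ?_
  by_cases hij : i = j
  · subst hij
    have h1 : Tendsto (fun a => M a i i - ∑ k ∈ Finset.univ.erase i, T a i k ^ 2) L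
        (𝓝 (diagonal lam i i - ∑ k ∈ Finset.univ.erase i, (0 : ℝ) ^ 2)) :=
      (tendsto_entry hM i i).sub (tendsto_finsetSum _ fun k hk =>
        (hoff i k (Finset.ne_of_mem_erase hk).symm).pow 2)
    simp only [ne_eq, OfNat.ofNat_ne_zero, not_false_eq_true, zero_pow, Finset.sum_const_zero,
      sub_zero, diagonal_apply_eq] at h1 ⊢
    refine h1.sqrt.congr' ?_
    filter_upwards [hsq, hT] with a ha ha'
    rw [← ha i, ← Finset.add_sum_erase _ _ (Finset.mem_univ i), add_sub_cancel_right,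
      Real.sqrt_sq ha'.1.diag_nonneg]
  · rw [diagonal_apply_ne _ hij]
    exact hoff i j hij

/-- Rate of convergence in `sqrt_tendsto_diagonal`. -/
theorem sqrt_sub_isBigO {lam : Fin p → ℝ} (hinj : Function.Injective lam) (hnn : ∀ i, 0 ≤ lam i)
    {M T : α → Matrix (Fin p) (Fin p) ℝ} {e : α → ℝ}
    (hM : ∀ i j, (fun a => (M a - diagonal lam) i j) =O[L] e)
    (hMt : Tendsto M L (𝓝 (diagonal lam)))
    (hker : ∀ᶠ a in L, ∀ j, lam j = 0 → M a j j = 0)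
    (hT : ∀ᶠ a in L, (T a).PosSemidef ∧ T a * T a = M a) (i j : Fin p) :
    (fun a => (T a - diagonal fun i => √(lam i)) i j) =O[L] e := by
  have hTt := sqrt_tendsto_diagonal hinj hMt hT
  have hoff (i j : Fin p) (hij : i ≠ j) : (fun a => T a i j) =O[L] e := by
    have h1 := ((isBigO_entry_mul hM hTt i j).sub (isBigO_mul_entry hM hTt i j)).const_mul_left
      (lam i - lam j)⁻¹
    refine h1.congr' (hT.mono fun a ha => ?_) EventuallyEq.rfl
    have hc : T a * M a = M a * T a := by rw [← ha.2, Matrix.mul_assoc]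
    simp only [Matrix.mul_sub, Matrix.sub_mul, Matrix.sub_apply, hc, mul_diagonal, diagonal_mul]
    have : lam i - lam j ≠ 0 := sub_ne_zero.2 (hinj.ne hij)
    field_simp
    ring
  have hsq : ∀ᶠ a in L, ∀ i, ∑ k, T a i k ^ 2 = M a i i := by
    refine hT.mono fun a ha i => ?_
    rw [← ha.2, Matrix.mul_apply]
    refine Finset.sum_congr rfl fun k _ => ?_
    have := ha.1.isHermitian.apply k i
    simp only [star_trivial] at this
    rw [this, sq]
  by_cases hij : i = j
  · subst hij
    simp only [Matrix.sub_apply, diagonal_apply_eq]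
    -- The root has infinite slope at `0`. If `lam i = 0`, `hker` makes row `i` of `T` vanish and
    -- the error is exactly zero; otherwise `T i i ^ 2 - lam i` is `O(e)` and is divided by `T i i +
    -- √(lam i)`, which stays away from `0`.
    rcases (hnn i).eq_or_lt with h0 | h0
    · refine IsBigO.of_bound 0 ?_
      filter_upwards [hsq, hker] with a ha ha'
      have h1 : T a i i ^ 2 ≤ 0 := by
        rw [← ha' i h0.symm, ← ha i]
        exact Finset.single_le_sum (f := fun k => T a i k ^ 2) (fun _ _ => sq_nonneg _)
          (Finset.mem_univ i)
      have h2 : T a i i = 0 := by nlinarith [sq_nonneg (T a i i)]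
      simp [h2, ← h0]
    · have hsum : (fun a => ∑ k ∈ Finset.univ.erase i, T a i k * T a i k) =O[L] e := by
        refine IsBigO.fun_sum fun k hk => ?_
        simpa using (hoff i k (Finset.ne_of_mem_erase hk).symm).mul
          ((tendsto_entry hTt i k).isBigO_one ℝ)
      have hinv : Tendsto (fun a => (T a i i + √(lam i))⁻¹) L (𝓝 (√(lam i) + √(lam i))⁻¹) := by
        refine Tendsto.inv₀ ?_ (by positivity)
        simpa using (tendsto_entry hTt i i).add_const (√(lam i))
      have h1 := ((hM i i).sub hsum).mul (hinv.isBigO_one ℝ)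
      simp only [mul_one] at h1
      refine h1.congr' ?_ EventuallyEq.rfl
      filter_upwards [hsq, hT] with a ha ha'
      have hpos : 0 < T a i i + √(lam i) :=
        add_pos_of_nonneg_of_pos ha'.1.diag_nonneg (Real.sqrt_pos.2 h0)
      simp only [Matrix.sub_apply, diagonal_apply_eq]
      rw [← ha i, ← Finset.add_sum_erase _ _ (Finset.mem_univ i)]
      simp only [sq]
      field_simp
      nlinarith [Real.mul_self_sqrt (hnn i)]
  · simpa [Matrix.sub_apply, diagonal_apply_ne _ hij] using hoff i j hij

/-! ### First order expansion of the eigenvalue equation -/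

/-- First order expansion of the solution of the perturbed eigenvalue equation. -/
theorem eigen_expansion {lam : Fin p → ℝ} (hinj : Function.Injective lam)
    {N K E : α → Matrix (Fin p) (Fin p) ℝ} {l : α → Fin p → ℝ} {e : α → ℝ}
    (hl : ∀ j, Tendsto (fun a => l a j) L (𝓝 (lam j))) (hN : Tendsto N L (𝓝 1))
    (hcol : ∀ᶠ a in L, ∀ j, ∑ i, N a i j ^ 2 = 1)
    (heq : ∀ᶠ a in L, ∀ i j, (l a j - lam i) * N a i j = K a i j)
    (hE : ∀ i j, (fun a => E a i j) =O[L] e)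
    (hKE : ∀ i j, (fun a => K a i j - E a i j) =o[L] e) :
    (∀ j, (fun a => l a j - lam j - E a j j) =o[L] e) ∧
      (∀ i j, i ≠ j → (fun a => N a i j - (lam j - lam i)⁻¹ * E a i j) =o[L] e) ∧
      ∀ j, (fun a => N a j j - 1) =o[L] e := by
  have hK (i j : Fin p) : (fun a => K a i j) =O[L] e := by
    simpa using (hKE i j).isBigO.add (hE i j)
  have hoff (i j : Fin p) (hij : i ≠ j) :
      (fun a => N a i j - (lam j - lam i)⁻¹ * E a i j) =o[L] e := by
    have hne : lam j - lam i ≠ 0 := sub_ne_zero.2 (hinj.ne hij.symm)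
    -- Off the diagonal the equation is divided by `l j - lam i`, whose limit is nonzero because the
    -- eigenvalues are distinct.
    have hlt : Tendsto (fun a => l a j - lam i) L (𝓝 (lam j - lam i)) := (hl j).sub_const _
    have h0 : (fun a => (l a j - lam i)⁻¹ - (lam j - lam i)⁻¹) =o[L] fun _ => (1 : ℝ) :=
      (isLittleO_one_iff ℝ).2 (by simpa using (hlt.inv₀ hne).sub_const (lam j - lam i)⁻¹)
    have h1 := (hK i j).mul_isLittleO h0
    have h2 := (hKE i j).const_mul_left (lam j - lam i)⁻¹
    simp only [mul_one] at h1
    refine (h1.add h2).congr' ?_ EventuallyEq.rfl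
    filter_upwards [heq, hlt.eventually_ne hne] with a ha ha'
    rw [← ha i j]
    field_simp
    ring
  refine ⟨fun j => ?_, hoff, fun j => ?_⟩
  -- On the diagonal `l j - lam j = K j j / N j j`, and `N j j → 1`.
  · have hinv : Tendsto (fun a => (N a j j)⁻¹) L (𝓝 1) := by
      simpa using (tendsto_entry hN j j).inv₀ (by simp)
    have h0 : (fun a => (N a j j)⁻¹ - 1) =o[L] fun _ => (1 : ℝ) :=
      (isLittleO_one_iff ℝ).2 (by simpa using hinv.sub_const 1)
    have h1 := (hK j j).mul_isLittleO h0
    simp only [mul_one] at h1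
    refine (h1.add (hKE j j)).congr' ?_ EventuallyEq.rfl
    filter_upwards [heq, (tendsto_entry hN j j).eventually_ne
      (by simp : (1 : Matrix (Fin p) (Fin p) ℝ) j j ≠ 0)] with a ha ha'
    rw [← ha j j]
    field_simp
    ring
  -- `1 - N j j ^ 2` is a sum of squares, each `O(e)` times `o(1)`; dividing by `N j j + 1` leaves
  -- `o(e)`.
  · have hsmall (i : Fin p) (hi : i ≠ j) : (fun a => N a i j * N a i j) =o[L] e := by
      have h1 : (fun a => N a i j) =O[L] e := by
        simpa using (hoff i j hi).isBigO.add ((hE i j).const_mul_left (lam j - lam i)⁻¹)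
      have h2 : (fun a => N a i j) =o[L] fun _ => (1 : ℝ) :=
        (isLittleO_one_iff ℝ).2 (by simpa [one_apply_ne hi] using tendsto_entry hN i j)
      simpa using h1.mul_isLittleO h2
    have hsum : (fun a => ∑ i ∈ Finset.univ.erase j, N a i j * N a i j) =o[L] e :=
      IsLittleO.fun_sum fun i hi => hsmall i (Finset.ne_of_mem_erase hi)
    have hlim : Tendsto (fun a => N a j j + 1) L (𝓝 (1 + 1)) := by
      simpa using (tendsto_entry hN j j).add_const 1
    have hinv : Tendsto (fun a => (N a j j + 1)⁻¹) L (𝓝 (1 + 1)⁻¹) := hlim.inv₀ (by norm_num)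
    have h1 := (hsum.mul_isBigO (hinv.isBigO_one ℝ)).neg_left
    simp only [mul_one] at h1
    refine h1.congr' ?_ EventuallyEq.rfl
    filter_upwards [hcol, hlim.eventually_ne (by norm_num : (1 + 1 : ℝ) ≠ 0)] with a ha ha'
    have := ha j
    rw [← Finset.add_sum_erase _ _ (Finset.mem_univ j)] at this
    rw [← div_eq_mul_inv, ← neg_div, div_eq_iff ha']
    simp only [sq] at this
    linarith

theorem tendsto_of_sub_isBigO {M : α → Matrix (Fin p) (Fin p) ℝ} {M' : Matrix (Fin p) (Fin p) ℝ}
    {e : α → ℝ} (he : Tendsto e L (𝓝 0)) (h : ∀ i j, (fun a => (M a - M') i j) =O[L] e) :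
    Tendsto M L (𝓝 M') := by
  refine tendsto_pi_nhds.2 fun i => tendsto_pi_nhds.2 fun j => ?_
  exact tendsto_sub_nhds_zero_iff.1 ((h i j).trans_tendsto he)

/-- First order expansion of the spectral decomposition at a diagonal matrix with distinct
entries in descending order. -/
theorem spectralDecomp_expansion {lam : Fin p → ℝ} (hlam : StrictAnti lam)
    {M Q : α → Matrix (Fin p) (Fin p) ℝ} {l : α → Fin p → ℝ} {e : α → ℝ}
    (he : Tendsto e L (𝓝 0)) (hM : ∀ i j, (fun a => (M a - diagonal lam) i j) =O[L] e)
    (h : ∀ᶠ a in L, IsSpectralDecomp (M a) (l a) (Q a)) (hpos : ∀ᶠ a in L, ∀ j, 0 ≤ Q a j j) :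
    (∀ j, (fun a => l a j - lam j - (M a - diagonal lam) j j) =o[L] e) ∧
      (∀ i j, i ≠ j →
        (fun a => Q a i j - (lam j - lam i)⁻¹ * (M a - diagonal lam) i j) =o[L] e) ∧
      ∀ j, (fun a => Q a j j - 1) =o[L] e := by
  have hMt := tendsto_of_sub_isBigO he hM
  obtain ⟨hl, hoff⟩ := spectralDecomp_tendsto hlam hMt h
  have hcol : ∀ᶠ a in L, ∀ j, ∑ i, Q a i j ^ 2 = 1 :=
    h.mono fun a ha j => sum_sq_col_of_orthogonal ha.orthogonal j
  have hQ : Tendsto Q L (𝓝 1) :=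
    tendsto_matrix_one (tendsto_diag_of_offDiag hcol hpos hoff) hoff
  -- This choice of `K` is `M Q = Q diag(l)` with `diag(lam) Q` subtracted; as `Q → 1`, it equals `M
  -- - diagonal lam` up to `o(e)`.
  refine eigen_expansion (K := fun a => (M a - diagonal lam) * Q a) hlam.injective hl hQ hcol
    ?_ hM fun i j => ?_
  · refine h.mono fun a ha i j => ?_
    have h1 : M a * Q a = Q a * diagonal (l a) := by
      conv_lhs => rw [ha.eq]
      rw [Matrix.mul_assoc, orthogonal_transpose_mul ha.orthogonal, Matrix.mul_one]
    rw [Matrix.sub_mul, Matrix.sub_apply, h1, mul_diagonal, diagonal_mul]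
    ring
  · simpa using isLittleO_mul_sub_entry hM hQ i j

end Filter

/-! ### First eigenvectors, sign conventions and singular values -/

theorem add_vecMulVec_mulVec {p : ℕ} (u v x : Fin p → ℝ) :
    (vecMulVec u u + vecMulVec v v) *ᵥ x = (u ⬝ᵥ x) • u + (v ⬝ᵥ x) • v := by
  rw [Matrix.add_mulVec]
  ext i
  simp only [Pi.add_apply, mulVec, dotProduct, vecMulVec_apply, Pi.smul_apply, smul_eq_mul,
    Finset.sum_mul]
  congr 1 <;> exact Finset.sum_congr rfl fun k _ => by ring

/-- The first eigenvector of `u uᵀ + v vᵀ`, for unit vectors at an acute angle, is proportional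
to `u + v`. -/
theorem IsFirstEigenvector.eq_smul_add {p : ℕ} {u v w : Fin p → ℝ} (hu : u ⬝ᵥ u = 1)
    (hv : v ⬝ᵥ v = 1) (huv : 0 < u ⬝ᵥ v)
    (h : IsFirstEigenvector (vecMulVec u u + vecMulVec v v) w) : ∃ s : ℝ, w = s • (u + v) := by
  obtain ⟨-, t, ht, hmax⟩ := h
  have hvu : v ⬝ᵥ u = u ⬝ᵥ v := dotProduct_comm _ _
  have hne : u + v ≠ 0 := by
    intro h0
    have h1 : u ⬝ᵥ (u + v) = 0 := by rw [h0, dotProduct_zero]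
    rw [dotProduct_add, hu] at h1
    linarith
  -- `u + v` is an eigenvector with eigenvalue `1 + u ⬝ᵥ v`, which bounds the largest eigenvalue
  -- from below.
  have hle : 1 + u ⬝ᵥ v ≤ t := by
    refine hmax _ (Module.End.hasEigenvalue_of_hasEigenvector (x := u + v) ⟨?_, hne⟩)
    rw [Module.End.mem_eigenspace_iff, Matrix.toLin'_apply, add_vecMulVec_mulVec, dotProduct_add,
      dotProduct_add, hu, hv, hvu, smul_add, add_comm (u ⬝ᵥ v) 1]
  rw [add_vecMulVec_mulVec] at ht
  have e1 : u ⬝ᵥ w + (v ⬝ᵥ w) * (u ⬝ᵥ v) = t * (u ⬝ᵥ w) := by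
    have := congrArg (fun x => u ⬝ᵥ x) ht
    simpa [dotProduct_add, dotProduct_smul, hu] using this
  have e2 : (u ⬝ᵥ w) * (u ⬝ᵥ v) + v ⬝ᵥ w = t * (v ⬝ᵥ w) := by
    have := congrArg (fun x => v ⬝ᵥ x) ht
    simpa [dotProduct_add, dotProduct_smul, hv, hvu] using this
  -- The first factor is at least `2 * (u ⬝ᵥ v) > 0`, so `w` has equal inner products with `u` and
  -- `v`.
  have e3 : (t - 1 + u ⬝ᵥ v) * (u ⬝ᵥ w - v ⬝ᵥ w) = 0 := by linear_combination e2 - e1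
  have e4 : u ⬝ᵥ w = v ⬝ᵥ w := by
    have := (mul_eq_zero.1 e3).resolve_left (by linarith)
    linarith
  have ht0 : t ≠ 0 := by linarith
  refine ⟨t⁻¹ * (u ⬝ᵥ w), ?_⟩
  rw [← e4, ← smul_add] at ht
  rw [mul_smul, ht, smul_smul, inv_mul_cancel₀ ht0, one_smul]

/-- The sign of a real number, with value `1` at zero. -/
noncomputable def signOne (x : ℝ) : ℝ := if 0 ≤ x then 1 else -1

theorem signOne_mul_self (x : ℝ) : signOne x * signOne x = 1 := by
  unfold signOne; split_ifs <;> norm_num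

theorem mul_signOne (x : ℝ) : x * signOne x = |x| := by
  unfold signOne
  split_ifs with h
  · rw [mul_one, abs_of_nonneg h]
  · rw [mul_neg_one, abs_of_neg (not_le.1 h)]

theorem signOne_eq_or (x : ℝ) : signOne x = 1 ∨ signOne x = -1 := by
  unfold signOne; split_ifs <;> simp

/-- Change the signs of the columns to make the diagonal nonnegative. -/
noncomputable def signedCols {p : ℕ} (U : Matrix (Fin p) (Fin p) ℝ) : Matrix (Fin p) (Fin p) ℝ :=
  Matrix.of fun i j => U i j * signOne (U j j)

theorem signedCols_apply {p : ℕ} (U : Matrix (Fin p) (Fin p) ℝ) (i j : Fin p) :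
    signedCols U i j = U i j * signOne (U j j) := rfl

theorem signedCols_diag_nonneg {p : ℕ} (U : Matrix (Fin p) (Fin p) ℝ) (j : Fin p) :
    0 ≤ signedCols U j j := by
  rw [signedCols_apply, mul_signOne]; exact abs_nonneg _

/-- `u uᵀ` does not see the sign of `u`, so singular vectors may be re-signed without changing the
first-eigenvector problem. -/
theorem vecMulVec_signedCols {p : ℕ} (U : Matrix (Fin p) (Fin p) ℝ) (j : Fin p) :
    vecMulVec ((signedCols U).col j) ((signedCols U).col j) = vecMulVec (U.col j) (U.col j) := by
  ext a b
  simp only [vecMulVec_apply, Matrix.col_apply, signedCols_apply]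
  linear_combination U a j * U b j * signOne_mul_self (U j j)

theorem sum_sq_signedCols {p : ℕ} {U : Matrix (Fin p) (Fin p) ℝ}
    (hU : U ∈ Matrix.orthogonalGroup (Fin p) ℝ) (j : Fin p) :
    ∑ i, signedCols U i j ^ 2 = 1 := by
  rw [← sum_sq_col_of_orthogonal hU j]
  refine Finset.sum_congr rfl fun i _ => ?_
  rw [signedCols_apply]
  linear_combination U i j ^ 2 * signOne_mul_self (U j j)

theorem mul_signedCols_apply {p : ℕ} (A U : Matrix (Fin p) (Fin p) ℝ) (i j : Fin p) :
    (A * signedCols U) i j = (A * U) i j * signOne (U j j) := by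
  simp only [Matrix.mul_apply, signedCols_apply, Finset.sum_mul, mul_assoc]

theorem dotProduct_col_self {p : ℕ} (N : Matrix (Fin p) (Fin p) ℝ) (j : Fin p) :
    N.col j ⬝ᵥ N.col j = ∑ i, N i j ^ 2 := by
  simp only [dotProduct, Matrix.col_apply, sq]

theorem IsSVD.transpose {p : ℕ} {A U V : Matrix (Fin p) (Fin p) ℝ} {l : Fin p → ℝ}
    (h : IsSVD A U l V) : IsSVD Aᵀ V l U where
  orthogonal_left := h.orthogonal_right
  orthogonal_right := h.orthogonal_left
  nonneg := h.nonneg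
  antitone := h.antitone
  eq := by
    rw [h.eq]
    simp only [Matrix.transpose_mul, Matrix.transpose_transpose, Matrix.diagonal_transpose,
      Matrix.mul_assoc]

theorem IsSVD.mul_right {p : ℕ} {A U V : Matrix (Fin p) (Fin p) ℝ} {l : Fin p → ℝ}
    (h : IsSVD A U l V) : A * V = U * diagonal l := by
  conv_lhs => rw [h.eq]
  rw [Matrix.mul_assoc, orthogonal_transpose_mul h.orthogonal_right, Matrix.mul_one]

/-- `A Aᵀ = U diag(l²) Uᵀ` reduces convergence of singular vectors to that of eigenvectors;
nonnegativity keeps the squares in order. -/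
theorem IsSVD.isSpectralDecomp {p : ℕ} {A U V : Matrix (Fin p) (Fin p) ℝ} {l : Fin p → ℝ}
    (h : IsSVD A U l V) : IsSpectralDecomp (A * Aᵀ) (fun i => l i * l i) U where
  orthogonal := h.orthogonal_left
  antitone := fun _ _ hij => mul_self_le_mul_self (h.nonneg _) (h.antitone hij)
  eq := by
    conv_lhs => rw [h.transpose.eq, ← Matrix.mul_assoc, ← Matrix.mul_assoc, h.mul_right]
    rw [Matrix.mul_assoc U, diagonal_mul_diagonal]

/-! ### First order expansion of product-PCA -/

section Filter

variable {α : Type*} {p : ℕ} {L : Filter α}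

/-- Singular value decompositions converge along any filter along which the matrices converge to
a nonnegative diagonal matrix with distinct entries in descending order. -/
theorem svd_tendsto {lam : Fin p → ℝ} (hlam : StrictAnti lam) (hnn : ∀ i, 0 ≤ lam i)
    {A U V : α → Matrix (Fin p) (Fin p) ℝ} {l : α → Fin p → ℝ}
    (hA : Tendsto A L (𝓝 (diagonal lam))) (h : ∀ᶠ a in L, IsSVD (A a) (U a) (l a) (V a)) :
    (∀ j, Tendsto (fun a => l a j) L (𝓝 (lam j))) ∧
      Tendsto (fun a => signedCols (U a)) L (𝓝 1) := by
  have hAA : Tendsto (fun a => A a * (A a)ᵀ) L (𝓝 (diagonal fun i => lam i * lam i)) := by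
    have := hA.mul ((continuous_id.matrix_transpose.tendsto _).comp hA)
    simpa [Function.comp_def] using this
  have hsq : StrictAnti fun i => lam i * lam i := fun i j hij =>
    mul_self_lt_mul_self (hnn j) (hlam hij)
  obtain ⟨hl, hoff⟩ := spectralDecomp_tendsto hsq hAA (h.mono fun a ha => ha.isSpectralDecomp)
  refine ⟨fun j => ?_, ?_⟩
  · have := (hl j).sqrt
    rw [Real.sqrt_mul_self (hnn j)] at this
    exact this.congr' (h.mono fun a ha => Real.sqrt_mul_self (ha.nonneg j))
  · have hoff' : ∀ i j, i ≠ j → Tendsto (fun a => signedCols (U a) i j) L (𝓝 0) := by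
      intro i j hij
      refine squeeze_zero_norm (fun a => le_of_eq ?_) (by simpa using (hoff i j hij).norm)
      rcases signOne_eq_or (U a j j) with h0 | h0 <;> simp [signedCols_apply, h0]
    exact tendsto_matrix_one (tendsto_diag_of_offDiag
      (h.mono fun a ha j => sum_sq_signedCols ha.orthogonal_left j)
      (Eventually.of_forall fun a j => signedCols_diag_nonneg _ j) hoff') hoff'

/-- With a common choice of signs, the left and right singular vectors remain paired. -/
theorem svd_signedCols {lam : Fin p → ℝ} (hlam : StrictAnti lam) (hnn : ∀ i, 0 ≤ lam i)
    {A U V : α → Matrix (Fin p) (Fin p) ℝ} {l : α → Fin p → ℝ}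
    (hA : Tendsto A L (𝓝 (diagonal lam))) (h : ∀ᶠ a in L, IsSVD (A a) (U a) (l a) (V a))
    (hker : ∀ᶠ a in L, ∀ j, lam j = 0 → ∀ k, A a j k = 0) :
    ∀ᶠ a in L, A a * signedCols (V a) = signedCols (U a) * diagonal (l a) ∧
      (A a)ᵀ * signedCols (U a) = signedCols (V a) * diagonal (l a) := by
  obtain ⟨hl, hU⟩ := svd_tendsto hlam hnn hA h
  have hAT : Tendsto (fun a => (A a)ᵀ) L (𝓝 (diagonal lam)) := by
    have := (continuous_id.matrix_transpose.tendsto _).comp hA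
    simpa [Function.comp_def] using this
  obtain ⟨-, hV⟩ := svd_tendsto hlam hnn hAT (h.mono fun a ha => ha.transpose)
  -- The signs of `u_j` and `v_j` are normalized separately; they must be shown to agree unless `l j
  -- = 0`.
  have key : ∀ᶠ a in L, ∀ j,
      l a j * signOne (U a j j) = l a j * signOne (V a j j) := by
    refine eventually_all.2 fun j => ?_
    have hUj : ∀ᶠ a in L, 0 < signedCols (U a) j j :=
      (tendsto_entry hU j j).eventually_const_lt (by simp)
    rcases (hnn j).eq_or_lt with h0 | h0
    -- Row `j` of `A` vanishes, so `l j * U j j = 0` with `U j j ≠ 0`: the singular value is zero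
    -- and the signs are irrelevant.
    · filter_upwards [h, hker, hUj] with a ha hka hua
      have e1 := congrFun (congrFun ha.mul_right j) j
      rw [mul_diagonal, Matrix.mul_apply] at e1
      simp only [hka j h0.symm, zero_mul, Finset.sum_const_zero] at e1
      have : l a j = 0 := by
        refine (mul_eq_zero.1 e1.symm).resolve_left fun hz => ?_
        rw [signedCols_apply, hz, zero_mul] at hua
        exact lt_irrefl _ hua
      rw [this, zero_mul, zero_mul]
    -- The entry `(A * signedCols V) j j` tends to `lam j > 0` and equals `U j j * l j` times the
    -- sign of `V j j`; hence that sign is the sign of `U j j`.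
    · have hAV : ∀ᶠ a in L, 0 < (A a * signedCols (V a)) j j := by
        refine (tendsto_entry (hA.mul hV) j j).eventually_const_lt ?_
        simpa using h0
      filter_upwards [h, hUj, hAV] with a ha hua hav
      rw [mul_signedCols_apply, ha.mul_right, mul_diagonal] at hav
      rw [signedCols_apply] at hua
      have hlj := ha.nonneg j
      congr 1
      rcases signOne_eq_or (U a j j) with h1 | h1 <;>
        rcases signOne_eq_or (V a j j) with h2 | h2 <;> rw [h1, h2] <;> exfalso <;>
          rw [h1] at hua <;> rw [h2] at hav <;> nlinarith
  filter_upwards [h, key] with a ha hka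
  constructor
  · ext i j
    rw [mul_signedCols_apply, ha.mul_right, mul_diagonal, mul_diagonal, signedCols_apply]
    linear_combination -(U a i j) * hka j
  · ext i j
    rw [mul_signedCols_apply, ha.transpose.mul_right, mul_diagonal, mul_diagonal,
      signedCols_apply]
    linear_combination (V a i j) * hka j

/-- First order expansion of product-PCA at a nonnegative diagonal matrix with distinct
entries in descending order. -/
theorem ppca_expansion {lam : Fin p → ℝ} (hlam : StrictAnti lam) (hnn : ∀ i, 0 ≤ lam i)
    {M₁ M₂ T₁ T₂ U V G : α → Matrix (Fin p) (Fin p) ℝ} {l : α → Fin p → ℝ} {e : α → ℝ}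
    (he : Tendsto e L (𝓝 0))
    (hM₁ : ∀ i j, (fun a => (M₁ a - diagonal lam) i j) =O[L] e)
    (hM₂ : ∀ i j, (fun a => (M₂ a - diagonal lam) i j) =O[L] e)
    (hker₁ : ∀ᶠ a in L, ∀ j, lam j = 0 → M₁ a j j = 0)
    (hker₂ : ∀ᶠ a in L, ∀ j, lam j = 0 → M₂ a j j = 0)
    (hT₁ : ∀ᶠ a in L, (T₁ a).PosSemidef ∧ T₁ a * T₁ a = M₁ a)
    (hT₂ : ∀ᶠ a in L, (T₂ a).PosSemidef ∧ T₂ a * T₂ a = M₂ a)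
    (h : ∀ᶠ a in L, IsSVD (T₁ a * T₂ a) (U a) (l a) (V a))
    (hG : ∀ᶠ a in L, ∀ j, IsFirstEigenvector
      (vecMulVec ((U a).col j) ((U a).col j) + vecMulVec ((V a).col j) ((V a).col j))
      ((G a).col j))
    (hpos : ∀ᶠ a in L, ∀ j, 0 ≤ G a j j) :
    (∀ j, (fun a => l a j - lam j -
        ((2 : ℝ)⁻¹ • (M₁ a - diagonal lam + (M₂ a - diagonal lam))) j j) =o[L] e) ∧
      (∀ i j, i ≠ j → (fun a => G a i j - (lam j - lam i)⁻¹ *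
        ((2 : ℝ)⁻¹ • (M₁ a - diagonal lam + (M₂ a - diagonal lam))) i j) =o[L] e) ∧
      ∀ j, (fun a => G a j j - 1) =o[L] e := by
  set R : Matrix (Fin p) (Fin p) ℝ := diagonal fun i => √(lam i) with hR
  have hRR : R * R = diagonal lam := by
    rw [hR, diagonal_mul_diagonal]
    simp only [Real.mul_self_sqrt (hnn _)]
  have hT₁t := sqrt_tendsto_diagonal hlam.injective (tendsto_of_sub_isBigO he hM₁) hT₁
  have hT₂t := sqrt_tendsto_diagonal hlam.injective (tendsto_of_sub_isBigO he hM₂) hT₂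
  have hD₁ := sqrt_sub_isBigO hlam.injective hnn hM₁ (tendsto_of_sub_isBigO he hM₁) hker₁ hT₁
  have hD₂ := sqrt_sub_isBigO hlam.injective hnn hM₂ (tendsto_of_sub_isBigO he hM₂) hker₂ hT₂
  rw [← hR] at hT₁t hT₂t
  simp only [← hR] at hD₁ hD₂
  have hA : Tendsto (fun a => T₁ a * T₂ a) L (𝓝 (diagonal lam)) := by
    rw [← hRR]; exact hT₁t.mul hT₂t
  -- A zero diagonal entry of `T₁²` is the squared length of a row of `T₁`, so that row vanishes,
  -- and with it the row of the product.
  have hkerA : ∀ᶠ a in L, ∀ j, lam j = 0 → ∀ k, (T₁ a * T₂ a) j k = 0 := by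
    filter_upwards [hker₁, hT₁] with a ha ha' j hj k
    have h0 := ha j hj
    rw [← ha'.2, Matrix.mul_apply] at h0
    have hz : ∀ i, T₁ a j i = 0 := by
      intro i
      have hs : ∀ i, T₁ a i j = T₁ a j i := fun i => by
        simpa using ha'.1.isHermitian.apply j i
      have := (Finset.sum_eq_zero_iff_of_nonneg (fun i _ => by
        rw [hs]; exact mul_self_nonneg _)).1 h0 i (Finset.mem_univ i)
      rw [hs] at this
      exact mul_self_eq_zero.1 this
    simp [Matrix.mul_apply, hz]
  obtain ⟨hl, hP⟩ := svd_tendsto hlam hnn hA h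
  have hAT : Tendsto (fun a => (T₁ a * T₂ a)ᵀ) L (𝓝 (diagonal lam)) := by
    have := (continuous_id.matrix_transpose.tendsto _).comp hA
    simpa [Function.comp_def] using this
  obtain ⟨-, hQ⟩ := svd_tendsto hlam hnn hAT (h.mono fun a ha => ha.transpose)
  have hsvd := svd_signedCols hlam hnn hA h hkerA
  -- the first eigenvectors
  have hc (j : Fin p) : Tendsto
      (fun a => (signedCols (U a)).col j ⬝ᵥ (signedCols (V a)).col j) L (𝓝 1) := by
    have := tendsto_entry (((continuous_id.matrix_transpose.tendsto _).comp hP).mul hQ) j j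
    simp only [id, transpose_one, Matrix.mul_one, one_apply_eq] at this
    exact this.congr fun a => by simp [Matrix.mul_apply, dotProduct]
  -- The scalars are defined for every `a`, with default `0` where the conditions fail, so that they
  -- form functions along `L`.
  have hs : ∀ a, ∃ s : Fin p → ℝ, ∀ j, 0 < (signedCols (U a)).col j ⬝ᵥ (signedCols (V a)).col j →
      IsSVD (T₁ a * T₂ a) (U a) (l a) (V a) → IsFirstEigenvector
        (vecMulVec ((U a).col j) ((U a).col j) + vecMulVec ((V a).col j) ((V a).col j))
        ((G a).col j) →
      (G a).col j = s j • ((signedCols (U a)).col j + (signedCols (V a)).col j) := by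
    intro a
    have : ∀ j, ∃ s : ℝ, 0 < (signedCols (U a)).col j ⬝ᵥ (signedCols (V a)).col j →
        IsSVD (T₁ a * T₂ a) (U a) (l a) (V a) → IsFirstEigenvector
          (vecMulVec ((U a).col j) ((U a).col j) + vecMulVec ((V a).col j) ((V a).col j))
          ((G a).col j) →
        (G a).col j = s • ((signedCols (U a)).col j + (signedCols (V a)).col j) := by
      intro j
      by_cases hcond : 0 < (signedCols (U a)).col j ⬝ᵥ (signedCols (V a)).col j ∧
        IsSVD (T₁ a * T₂ a) (U a) (l a) (V a) ∧ IsFirstEigenvector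
          (vecMulVec ((U a).col j) ((U a).col j) + vecMulVec ((V a).col j) ((V a).col j))
          ((G a).col j)
      · obtain ⟨h1, h2, h3⟩ := hcond
        rw [← vecMulVec_signedCols (U a), ← vecMulVec_signedCols (V a)] at h3
        obtain ⟨s, hs⟩ := h3.eq_smul_add
          (by rw [dotProduct_col_self, sum_sq_signedCols h2.orthogonal_left])
          (by rw [dotProduct_col_self, sum_sq_signedCols h2.orthogonal_right]) h1
        exact ⟨s, fun _ _ _ => hs⟩
      · exact ⟨0, fun h1 h2 h3 => absurd ⟨h1, h2, h3⟩ hcond⟩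
    choose s hs using this
    exact ⟨s, hs⟩
  choose s hs using hs
  have hGs : ∀ᶠ a in L, ∀ j,
      (G a).col j = s a j • ((signedCols (U a)).col j + (signedCols (V a)).col j) := by
    filter_upwards [h, hG, eventually_all.2 fun j => (hc j).eventually_const_lt zero_lt_one]
      with a h1 h2 h3 j
    exact hs a j (h3 j) h1 (h2 j)
  have hcol : ∀ᶠ a in L, ∀ j, ∑ i, G a i j ^ 2 = 1 := hG.mono fun a ha j => by
    rw [← dotProduct_col_self]; exact (ha j).1
  -- Unit length gives `s² (2 + 2 u ⬝ᵥ v) = 1`; the sign condition on `G` selects the positive root,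
  -- which tends to `1/2`.
  have hst (j : Fin p) : Tendsto (fun a => s a j) L (𝓝 2⁻¹) := by
    have hlim : Tendsto (fun a =>
        √((2 + 2 * ((signedCols (U a)).col j ⬝ᵥ (signedCols (V a)).col j))⁻¹)) L (𝓝 2⁻¹) := by
      have := (((hc j).const_mul 2).const_add 2).inv₀ (by norm_num)
      have h4 : √((2 + 2 * 1)⁻¹ : ℝ) = 2⁻¹ := by
        rw [show ((2 + 2 * 1)⁻¹ : ℝ) = 2⁻¹ * 2⁻¹ by norm_num, Real.sqrt_mul_self (by norm_num)]
      rw [← h4]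
      exact this.sqrt
    refine hlim.congr' ?_
    filter_upwards [h, hGs, hcol, hpos, (hc j).eventually_const_lt zero_lt_one,
      (tendsto_entry hP j j).eventually_const_lt (by simp : (0 : ℝ) < (1 : Matrix (Fin p) (Fin p) ℝ) j j)]
      with a h1 h2 h3 h4 h5 h6
    set u := (signedCols (U a)).col j
    set v := (signedCols (V a)).col j
    have hu : u ⬝ᵥ u = 1 := by
      rw [dotProduct_col_self, sum_sq_signedCols h1.orthogonal_left]
    have hv : v ⬝ᵥ v = 1 := by
      rw [dotProduct_col_self, sum_sq_signedCols h1.orthogonal_right]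
    have e1 : s a j ^ 2 * (2 + 2 * (u ⬝ᵥ v)) = 1 := by
      have := h3 j
      have h2j : (G a).col j = s a j • (u + v) := h2 j
      rw [← dotProduct_col_self, h2j] at this
      simp only [smul_dotProduct, dotProduct_smul, dotProduct_add, add_dotProduct, hu, hv,
        dotProduct_comm v u, smul_eq_mul] at this
      linarith
    have hs0 : 0 ≤ s a j := by
      have h7 := h4 j
      have h8 := congrFun (h2 j) j
      have h9 := signedCols_diag_nonneg (V a) j
      rw [Pi.smul_apply, smul_eq_mul, Matrix.col_apply] at h8
      rw [h8] at h7
      refine nonneg_of_mul_nonneg_left h7 ?_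
      exact add_pos_of_pos_of_nonneg h6 h9
    rw [← eq_inv_of_mul_eq_one_left e1, Real.sqrt_sq hs0]
  set S : α → Matrix (Fin p) (Fin p) ℝ := fun a => signedCols (U a) + signedCols (V a) with hS
  have hSt : Tendsto S L (𝓝 (1 + 1)) := hP.add hQ
  have hGS : ∀ᶠ a in L, ∀ i j, G a i j = s a j * S a i j := hGs.mono fun a ha i j =>
    congrFun (ha j) i
  have hGt : Tendsto G L (𝓝 1) := by
    refine tendsto_pi_nhds.2 fun i => tendsto_pi_nhds.2 fun j => ?_
    have h1 := (hst j).mul (tendsto_entry hSt i j)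
    have h2 : (2 : ℝ)⁻¹ * ((1 : Matrix (Fin p) (Fin p) ℝ) + 1) i j =
        (1 : Matrix (Fin p) (Fin p) ℝ) i j := by
      rw [Matrix.add_apply]; ring
    rw [h2] at h1
    exact h1.congr' (hGS.mono fun a ha => (ha i j).symm)
  -- the perturbation of the product
  set F : α → Matrix (Fin p) (Fin p) ℝ := fun a => T₁ a * T₂ a - diagonal lam with hF
  have hFO : ∀ i j, (fun a => F a i j) =O[L] e := by
    intro i j
    have h1 := (isBigO_mul_entry hD₁ hT₂t i j).add
      (isBigO_entry_mul hD₂ (tendsto_const_nhds (x := R)) i j)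
    refine h1.congr_left fun a => ?_
    have e1 : (T₁ a - R) * T₂ a + R * (T₂ a - R) = F a := by
      rw [Matrix.sub_mul, Matrix.mul_sub, hRR, sub_add_sub_cancel]
    rw [← Matrix.add_apply, e1]
  have hFTO : ∀ i j, (fun a => (F a)ᵀ i j) =O[L] e := fun i j => hFO j i
  have hK₁ (i j : Fin p) : (fun a => (F a * signedCols (V a)) i j - F a i j) =o[L] e := by
    simpa using isLittleO_mul_sub_entry hFO hQ i j
  have hK₂ (i j : Fin p) : (fun a => ((F a)ᵀ * signedCols (U a)) i j - (F a)ᵀ i j) =o[L] e := by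
    simpa using isLittleO_mul_sub_entry hFTO hP i j
  set E : α → Matrix (Fin p) (Fin p) ℝ := fun a =>
    (2 : ℝ)⁻¹ • (M₁ a - diagonal lam + (M₂ a - diagonal lam)) with hE
  have hEO (i j : Fin p) : (fun a => E a i j) =O[L] e :=
    ((hM₁ i j).add (hM₂ i j)).const_mul_left 2⁻¹
  have hdiff : ∀ i j, (fun a => (T₁ a - T₂ a) i j) =O[L] e := fun i j =>
    ((hD₁ i j).sub (hD₂ i j)).congr_left fun a => by
      rw [← Matrix.sub_apply, sub_sub_sub_cancel_right]
  have hdiff0 : Tendsto (fun a => T₁ a - T₂ a) L (𝓝 0) := by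
    simpa using hT₁t.sub hT₂t
  have hsqo (i j : Fin p) :
      (fun a => ((T₁ a - T₂ a) * (T₁ a - T₂ a)) i j) =o[L] e := by
    simpa using isLittleO_mul_sub_entry hdiff hdiff0 i j
  -- Since `T₁T₂ + T₂T₁ = T₁² + T₂² - (T₁ - T₂)²` and `T₁ - T₂ = O(e)`, the symmetric part of the
  -- product is the mean of `M₁` and `M₂` up to `o(e)`; the derivative of the square root never
  -- appears.
  have hFE (i j : Fin p) : (fun a => 2⁻¹ * (F a i j + (F a)ᵀ i j) - E a i j) =o[L] e := by
    refine ((hsqo i j).const_mul_left (-2⁻¹)).congr' ?_ EventuallyEq.rfl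
    filter_upwards [hT₁, hT₂] with a h1 h2
    have e1 : (T₁ a * T₂ a)ᵀ = T₂ a * T₁ a := by
      rw [Matrix.transpose_mul]
      congr 1
      · simpa using h2.1.isHermitian.eq
      · simpa using h1.1.isHermitian.eq
    have e2 : F a + (F a)ᵀ = M₁ a - diagonal lam + (M₂ a - diagonal lam) -
        (T₁ a - T₂ a) * (T₁ a - T₂ a) := by
      simp only [hF, Matrix.transpose_sub, e1, diagonal_transpose, Matrix.sub_mul,
        Matrix.mul_sub, h1.2, h2.2]
      abel
    rw [← Matrix.add_apply, e2]
    simp only [hE, Matrix.smul_apply, Matrix.sub_apply, smul_eq_mul]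
    ring
  -- Adding `A v = l u` and `Aᵀ u = l v` gives `u + v`, hence `G`, an equation of eigenvalue type.
  refine eigen_expansion
    (K := fun a => of fun i j =>
      s a j * ((F a * signedCols (V a)) i j + ((F a)ᵀ * signedCols (U a)) i j))
    hlam.injective hl hGt hcol ?_ hEO fun i j => ?_
  · filter_upwards [hGS, hsvd] with a h1 h2 i j
    rw [h1, of_apply]
    have e1 := congrFun (congrFun h2.1 i) j
    have e2 := congrFun (congrFun h2.2 i) j
    rw [mul_diagonal] at e1 e2
    simp only [hF, hS, Matrix.transpose_sub, diagonal_transpose, Matrix.sub_mul, Matrix.sub_apply,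
      Matrix.add_apply, diagonal_mul, e1, e2]
    ring
  · simp only [of_apply]
    have hs1 : (fun a => s a j) =O[L] fun _ => (1 : ℝ) := (hst j).isBigO_one ℝ
    have hs0 : (fun a => s a j - 2⁻¹) =o[L] fun _ => (1 : ℝ) :=
      (isLittleO_one_iff ℝ).2 (by simpa using (hst j).sub_const 2⁻¹)
    have t1 := hs1.mul_isLittleO ((hK₁ i j).add (hK₂ i j))
    have t2 := hs0.mul_isBigO ((hFO i j).add (hFTO i j))
    simp only [one_mul] at t1 t2
    refine ((t1.add t2).add (hFE i j)).congr_left fun a => ?_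
    ring

end Filter

/-! ### The Moore-Penrose inverse and the derivative `Hᵀ vec` -/

/-- The Penrose equations determine the Moore-Penrose inverse. -/
theorem penrose_unique {n : Type*} [Fintype n] {A X Y : Matrix n n ℝ}
    (hX₁ : A * X * A = A) (hX₂ : X * A * X = X) (hX₃ : (A * X)ᵀ = A * X) (hX₄ : (X * A)ᵀ = X * A)
    (hY₁ : A * Y * A = A) (hY₂ : Y * A * Y = Y) (hY₃ : (A * Y)ᵀ = A * Y) (hY₄ : (Y * A)ᵀ = Y * A) :
    X = Y := by
  have h1 : A * X = A * Y := by
    calc A * X = (A * X)ᵀ := hX₃.symm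
      _ = ((A * Y) * (A * X))ᵀ := by rw [← Matrix.mul_assoc, hY₁]
      _ = A * X * (A * Y) := by rw [Matrix.transpose_mul, hX₃, hY₃]
      _ = A * Y := by rw [← Matrix.mul_assoc, hX₁]
  have h2 : X * A = Y * A := by
    calc X * A = (X * A)ᵀ := hX₄.symm
      _ = ((X * A) * (Y * A))ᵀ := by rw [Matrix.mul_assoc, ← Matrix.mul_assoc A Y A, hY₁]
      _ = Y * A * (X * A) := by rw [Matrix.transpose_mul, hX₄, hY₄]
      _ = Y * A := by rw [Matrix.mul_assoc, ← Matrix.mul_assoc A X A, hX₁]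
  rw [← hX₂, h2, Matrix.mul_assoc, h1, ← Matrix.mul_assoc, hY₂]

/-- Both sides satisfy the Penrose equations; for the diagonal these amount to `a * a⁻¹ * a = a`,
valid also at `0`. -/
theorem symmPinv_conj_diagonal {p : ℕ} {G : Matrix (Fin p) (Fin p) ℝ}
    (hG : G ∈ Matrix.orthogonalGroup (Fin p) ℝ) (d : Fin p → ℝ) :
    symmPinv (G * diagonal d * Gᵀ) = G * diagonal (fun i => (d i)⁻¹) * Gᵀ := by
  have hGG := orthogonal_transpose_mul hG
  have hprod (a b : Fin p → ℝ) :
      G * diagonal a * Gᵀ * (G * diagonal b * Gᵀ) = G * diagonal (fun i => a i * b i) * Gᵀ := by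
    calc _ = G * diagonal a * (Gᵀ * G) * diagonal b * Gᵀ := by simp only [Matrix.mul_assoc]
      _ = _ := by rw [hGG, Matrix.mul_one, Matrix.mul_assoc G, diagonal_mul_diagonal]
  have hsymm (a : Fin p → ℝ) : (G * diagonal a * Gᵀ)ᵀ = G * diagonal a * Gᵀ := by
    simp only [Matrix.transpose_mul, transpose_transpose, diagonal_transpose, Matrix.mul_assoc]
  have hherm : (G * diagonal d * Gᵀ).IsHermitian := by
    rw [Matrix.IsHermitian, conjTranspose_eq_transpose_of_trivial, hsymm]
  obtain ⟨h1, h2, h3, h4⟩ := symmPinv_penrose hherm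
  rw [Matrix.IsHermitian, conjTranspose_eq_transpose_of_trivial] at h3 h4
  refine penrose_unique h1 h2 h3 h4 ?_ ?_ ?_ ?_
  · rw [hprod, hprod]
    simp only [mul_inv_mul_cancel]
  · rw [hprod, hprod]
    have : (fun i => (d i)⁻¹ * d i * (d i)⁻¹) = fun i => (d i)⁻¹ := funext fun i => by
      simpa using mul_inv_mul_cancel (d i)⁻¹
    rw [this]
  · rw [hprod, hsymm]
  · rw [hprod, hsymm]

theorem IsSpectralDecomp.symmPinv_sub {p : ℕ} {S G : Matrix (Fin p) (Fin p) ℝ} {l : Fin p → ℝ}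
    (h : IsSpectralDecomp S l G) (x : ℝ) :
    symmPinv (x • 1 - S) = G * diagonal (fun i => (x - l i)⁻¹) * Gᵀ := by
  rw [← symmPinv_conj_diagonal h.orthogonal]
  congr 1
  have : diagonal (fun i => x - l i) = x • 1 - diagonal l := by
    rw [smul_one_eq_diagonal, diagonal_sub]
  rw [this, Matrix.mul_sub, Matrix.sub_mul, ← h.eq, Matrix.mul_smul, Matrix.mul_one,
    Matrix.smul_mul, orthogonal_mul_transpose h.orthogonal]

/-- The derivative `E ↦ Hᵀ vec E` of the spectral decomposition `(l, G)` at `S`. -/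
noncomputable def betaDeriv {p : ℕ} (S : Matrix (Fin p) (Fin p) ℝ) (l : Fin p → ℝ)
    (G : Matrix (Fin p) (Fin p) ℝ) :
    Matrix (Fin p) (Fin p) ℝ →ₗ[ℝ] EuclideanSpace ℝ (Fin p ⊕ Fin p × Fin p) where
  toFun E := WithLp.toLp 2 ((matH S l G)ᵀ *ᵥ vec E)
  map_add' A B := by rw [vec_add, mulVec_add, WithLp.toLp_add]
  map_smul' c A := by rw [vec_smul, mulVec_smul, WithLp.toLp_smul, RingHom.id_apply]

/-- `vec` stacks columns, so the index `(a, b)` stands for the entry in row `b` and column `a`. -/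
theorem betaDeriv_apply {p : ℕ} (S : Matrix (Fin p) (Fin p) ℝ) (l : Fin p → ℝ)
    (G E : Matrix (Fin p) (Fin p) ℝ) (c : Fin p ⊕ Fin p × Fin p) :
    betaDeriv S l G E c = ∑ a, ∑ b, matH S l G (a, b) c * E b a := by
  rw [← Finset.sum_product']
  rfl

theorem betaDeriv_inl {p : ℕ} (S : Matrix (Fin p) (Fin p) ℝ) (l : Fin p → ℝ)
    (G E : Matrix (Fin p) (Fin p) ℝ) (j : Fin p) :
    betaDeriv S l G E (Sum.inl j) = (Gᵀ * E * G) j j := by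
  rw [betaDeriv_apply, Matrix.mul_apply]
  simp only [Matrix.mul_apply, Finset.sum_mul]
  refine Finset.sum_congr rfl fun a _ => Finset.sum_congr rfl fun b _ => ?_
  simp only [matH, fromCols_apply_inl, of_apply, transpose_apply]
  ring

/-- By symmetry of `M_j`, the block `γ_j ⊗ M_j` produces `M_j E γ_j`, here expanded in the
eigenbasis. The term `i = j` drops out because `0⁻¹ = 0`. -/
theorem betaDeriv_inr {p : ℕ} {S G : Matrix (Fin p) (Fin p) ℝ} {l : Fin p → ℝ}
    (h : IsSpectralDecomp S l G) (E : Matrix (Fin p) (Fin p) ℝ) (j k : Fin p) :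
    betaDeriv S l G E (Sum.inr (j, k)) =
      ∑ i, G k i * ((l j - l i)⁻¹ * (Gᵀ * E * G) i j) := by
  have h1 : ∑ i, G k i * ((l j - l i)⁻¹ * (Gᵀ * E * G) i j) =
      (symmPinv (l j • 1 - S) * E * G : Matrix (Fin p) (Fin p) ℝ) k j := by
    rw [h.symmPinv_sub]
    have : G * diagonal (fun i => (l j - l i)⁻¹) * Gᵀ * E * G =
        G * (diagonal (fun i => (l j - l i)⁻¹) * (Gᵀ * E * G)) := by
      simp only [Matrix.mul_assoc]
    rw [this, Matrix.mul_apply]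
    simp only [diagonal_mul]
  have hsymm (a b : Fin p) : symmPinv (l j • 1 - S) a b = symmPinv (l j • 1 - S) b a := by
    have : (symmPinv (l j • 1 - S))ᵀ = symmPinv (l j • 1 - S) := by
      rw [h.symmPinv_sub]
      simp only [Matrix.transpose_mul, transpose_transpose, diagonal_transpose, Matrix.mul_assoc]
    exact congrFun (congrFun this b) a
  rw [h1, betaDeriv_apply, Matrix.mul_apply]
  simp only [Matrix.mul_apply, Finset.sum_mul]
  refine Finset.sum_congr rfl fun a _ => Finset.sum_congr rfl fun b _ => ?_
  simp only [matH, fromCols_apply_inr, of_apply]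
  rw [hsymm b k]
  ring

/-! ### Rotation to the eigenbasis -/

theorem IsSpectralDecomp.conj_eq {p : ℕ} {S G : Matrix (Fin p) (Fin p) ℝ} {l : Fin p → ℝ}
    (h : IsSpectralDecomp S l G) : Gᵀ * S * G = diagonal l := by
  have h1 := orthogonal_transpose_mul h.orthogonal
  calc Gᵀ * S * G = (Gᵀ * G) * diagonal l * (Gᵀ * G) := by
        conv_lhs => rw [h.eq]
        simp only [Matrix.mul_assoc]
    _ = diagonal l := by rw [h1, Matrix.one_mul, Matrix.mul_one]

theorem transpose_mem_orthogonalGroup {p : ℕ} {O : Matrix (Fin p) (Fin p) ℝ}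
    (hO : O ∈ Matrix.orthogonalGroup (Fin p) ℝ) : Oᵀ ∈ Matrix.orthogonalGroup (Fin p) ℝ := by
  rw [Matrix.mem_orthogonalGroup_iff, transpose_transpose]
  exact orthogonal_transpose_mul hO

theorem IsSpectralDecomp.rotate {p : ℕ} {S G O : Matrix (Fin p) (Fin p) ℝ} {l : Fin p → ℝ}
    (h : IsSpectralDecomp S l G) (hO : O ∈ Matrix.orthogonalGroup (Fin p) ℝ) :
    IsSpectralDecomp (Oᵀ * S * O) l (Oᵀ * G) where
  orthogonal := mul_mem (transpose_mem_orthogonalGroup hO) h.orthogonal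
  antitone := h.antitone
  eq := by
    conv_lhs => rw [h.eq]
    simp only [Matrix.transpose_mul, transpose_transpose, Matrix.mul_assoc]

theorem IsSVD.rotate {p : ℕ} {A U V O : Matrix (Fin p) (Fin p) ℝ} {l : Fin p → ℝ}
    (h : IsSVD A U l V) (hO : O ∈ Matrix.orthogonalGroup (Fin p) ℝ) :
    IsSVD (Oᵀ * A * O) (Oᵀ * U) l (Oᵀ * V) where
  orthogonal_left := mul_mem (transpose_mem_orthogonalGroup hO) h.orthogonal_left
  orthogonal_right := mul_mem (transpose_mem_orthogonalGroup hO) h.orthogonal_right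
  nonneg := h.nonneg
  antitone := h.antitone
  eq := by
    conv_lhs => rw [h.eq]
    simp only [Matrix.transpose_mul, transpose_transpose, Matrix.mul_assoc]

theorem col_transpose_mul {p : ℕ} (O G : Matrix (Fin p) (Fin p) ℝ) (j : Fin p) :
    (Oᵀ * G).col j = Oᵀ *ᵥ G.col j := by
  ext i
  simp only [Matrix.col_apply, Matrix.mul_apply, mulVec, dotProduct]

theorem vecMulVec_rotate {p : ℕ} (O : Matrix (Fin p) (Fin p) ℝ) (u : Fin p → ℝ) :
    vecMulVec (Oᵀ *ᵥ u) (Oᵀ *ᵥ u) = Oᵀ * vecMulVec u u * O := by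
  rw [Matrix.mul_vecMulVec, Matrix.vecMulVec_mul, Matrix.mulVec_transpose]

theorem IsFirstEigenvector.rotate {p : ℕ} {A O : Matrix (Fin p) (Fin p) ℝ} {w : Fin p → ℝ}
    (h : IsFirstEigenvector A w) (hO : O ∈ Matrix.orthogonalGroup (Fin p) ℝ) :
    IsFirstEigenvector (Oᵀ * A * O) (Oᵀ *ᵥ w) := by
  have hOO := orthogonal_mul_transpose hO
  have hOw (x : Fin p → ℝ) : O *ᵥ (Oᵀ *ᵥ x) = x := by rw [mulVec_mulVec, hOO, one_mulVec]
  obtain ⟨hw, t, ht, hmax⟩ := h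
  refine ⟨?_, t, ?_, fun r hr => hmax r ?_⟩
  · rw [dotProduct_mulVec, vecMul_transpose, hOw, hw]
  · rw [← mulVec_mulVec, hOw, ← mulVec_mulVec, ht, mulVec_smul]
  · obtain ⟨x, hx⟩ := hr.exists_hasEigenvector
    have hx1 := Module.End.mem_eigenspace_iff.1 hx.1
    rw [Matrix.toLin'_apply] at hx1
    refine Module.End.hasEigenvalue_of_hasEigenvector (x := O *ᵥ x) ⟨?_, fun h0 => hx.2 ?_⟩
    · rw [Module.End.mem_eigenspace_iff, Matrix.toLin'_apply, ← mulVec_smul, ← hx1, mulVec_mulVec,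
        mulVec_mulVec]
      congr 1
      rw [← Matrix.mul_assoc, ← Matrix.mul_assoc, hOO, Matrix.one_mul]
    · rw [← one_mulVec x, ← orthogonal_transpose_mul hO, ← mulVec_mulVec, h0, mulVec_zero]

/-- The expansions only use a positive semidefinite `T` with `T * T = M`, so the rotated root need
not be identified with the root of the rotated matrix. -/
theorem psdSqrt_rotate {p : ℕ} {S O : Matrix (Fin p) (Fin p) ℝ} (hS : S.PosSemidef)
    (hO : O ∈ Matrix.orthogonalGroup (Fin p) ℝ) :
    (Oᵀ * psdSqrt S * O).PosSemidef ∧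
      Oᵀ * psdSqrt S * O * (Oᵀ * psdSqrt S * O) = Oᵀ * S * O := by
  constructor
  · have := (psdSqrt_posSemidef S).conjTranspose_mul_mul_same O
    rwa [conjTranspose_eq_transpose_of_trivial] at this
  · calc _ = Oᵀ * psdSqrt S * (O * Oᵀ) * psdSqrt S * O := by simp only [Matrix.mul_assoc]
      _ = Oᵀ * (psdSqrt S * psdSqrt S) * O := by
        rw [orthogonal_mul_transpose hO, Matrix.mul_one]; simp only [Matrix.mul_assoc]
      _ = _ := by rw [psdSqrt_mul_self hS]

section Filter

variable {α : Type*} {p : ℕ} {L : Filter α}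

theorem isLittleO_euclideanSpace {ι : Type*} [Fintype ι] {f : α → EuclideanSpace ℝ ι} {e : α → ℝ}
    (h : ∀ c, (fun a => f a c) =o[L] e) : f =o[L] e := by
  classical
  have h1 : (fun a => ∑ c, f a c • EuclideanSpace.basisFun ι ℝ c) =o[L] e :=
    IsLittleO.fun_sum fun c _ => by
      have := (h c).smul_isBigO (isBigO_refl (fun _ : α => EuclideanSpace.basisFun ι ℝ c) L)
      refine this.trans_isBigO (IsBigO.of_bound ‖EuclideanSpace.basisFun ι ℝ c‖ ?_)
      exact Eventually.of_forall fun a => by rw [norm_smul, mul_comm]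
  refine h1.congr_left fun a => ?_
  have := (EuclideanSpace.basisFun ι ℝ).sum_repr (f a)
  simpa using this

theorem isBigO_conj {S O : Matrix (Fin p) (Fin p) ℝ} {M : α → Matrix (Fin p) (Fin p) ℝ} {e : α → ℝ}
    (h : ∀ i j, (fun a => M a i j - S i j) =O[L] e) (i j : Fin p) :
    (fun a => (Oᵀ * M a * O - Oᵀ * S * O) i j) =O[L] e := by
  have h1 := isBigO_mul_entry (L := L) (isBigO_entry_mul (E := fun a => M a - S)
    (N := fun _ => Oᵀ) (fun i j => h i j) tendsto_const_nhds)
    (N := fun _ => O) tendsto_const_nhds i j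
  refine h1.congr_left fun a => ?_
  rw [Matrix.mul_sub, Matrix.sub_mul]

/-- Expansions in the eigenbasis translate into expansions of the parameter vector. -/
theorem betaVec_isLittleO {S G : Matrix (Fin p) (Fin p) ℝ} {l : Fin p → ℝ}
    (h : IsSpectralDecomp S l G) {E Gh : α → Matrix (Fin p) (Fin p) ℝ} {lh : α → Fin p → ℝ}
    {e : α → ℝ}
    (h₁ : ∀ j, (fun a => lh a j - l j - (Gᵀ * E a * G) j j) =o[L] e)
    (h₂ : ∀ i j, i ≠ j →
      (fun a => (Gᵀ * Gh a) i j - (l j - l i)⁻¹ * (Gᵀ * E a * G) i j) =o[L] e)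
    (h₃ : ∀ j, (fun a => (Gᵀ * Gh a) j j - 1) =o[L] e) :
    (fun a => betaVec (lh a) (Gh a) - betaVec l G - betaDeriv S l G (E a)) =o[L] e := by
  refine isLittleO_euclideanSpace fun c => ?_
  rcases c with j | ⟨j, k⟩
  · refine (h₁ j).congr_left fun a => ?_
    rw [PiLp.sub_apply, PiLp.sub_apply, betaDeriv_inl]
    rfl
  · have hi (i : Fin p) : (fun a => G k i * ((Gᵀ * Gh a) i j - (1 : Matrix (Fin p) (Fin p) ℝ) i j -
        (l j - l i)⁻¹ * (Gᵀ * E a * G) i j)) =o[L] e := by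
      refine IsLittleO.const_mul_left ?_ _
      by_cases hij : i = j
      · subst hij
        simpa using h₃ i
      · simpa [one_apply_ne hij] using h₂ i j hij
    refine (IsLittleO.fun_sum (s := Finset.univ) fun i _ => hi i).congr_left fun a => ?_
    rw [PiLp.sub_apply, PiLp.sub_apply, betaDeriv_inr h]
    have e1 : ∑ i, G k i * (Gᵀ * Gh a) i j = Gh a k j := by
      rw [← Matrix.mul_apply, ← Matrix.mul_assoc, orthogonal_mul_transpose h.orthogonal,
        Matrix.one_mul]
    have e2 : ∑ i, G k i * (1 : Matrix (Fin p) (Fin p) ℝ) i j = G k j := by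
      rw [← Matrix.mul_apply, Matrix.mul_one]
    simp only [mul_sub, Finset.sum_sub_distrib]
    rw [e1, e2]
    rfl

theorem betaDeriv_isLittleO (S G : Matrix (Fin p) (Fin p) ℝ) (l : Fin p → ℝ)
    {E : α → Matrix (Fin p) (Fin p) ℝ} {e : α → ℝ} (h : ∀ i j, (fun a => E a i j) =o[L] e) :
    (fun a => betaDeriv S l G (E a)) =o[L] e := by
  refine isLittleO_euclideanSpace fun c => ?_
  simp only [betaDeriv_apply]
  exact IsLittleO.fun_sum fun a _ => IsLittleO.fun_sum fun b _ => (h b a).const_mul_left _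

end Filter

/-! ### Uniform linearization of both estimators -/

/-- The uniform form of a first order estimate, over all tuples satisfying some constraint. -/
theorem exists_delta_of_isLittleO {α E : Type*} [NormedAddCommGroup E] {V : Set α} {e : α → ℝ}
    {f : α → E} (h : f =o[comap e (𝓝 0) ⊓ 𝓟 V] e) {η : ℝ} (hη : 0 < η) :
    ∃ δ > 0, ∀ a ∈ V, |e a| < δ → ‖f a‖ ≤ η * |e a| := by
  have h1 := (isLittleO_iff.1 h) hη
  rw [eventually_inf_principal, eventually_comap, Metric.eventually_nhds_iff] at h1
  obtain ⟨δ, hδ, h2⟩ := h1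
  refine ⟨δ, hδ, fun a ha hae => ?_⟩
  have := h2 (y := e a) (by simpa using hae) a rfl ha
  simpa using this

theorem isBigO_of_mem_constraint {α : Type*} {V : Set α} {e f : α → ℝ} (C : ℝ)
    (h : ∀ a ∈ V, |e a| < 1 → |f a| ≤ C * |e a|) : f =O[comap e (𝓝 0) ⊓ 𝓟 V] e := by
  refine IsBigO.of_bound C ?_
  rw [eventually_inf_principal, eventually_comap, Metric.eventually_nhds_iff]
  refine ⟨1, one_pos, ?_⟩
  rintro y hy a rfl ha
  exact h a ha (by simpa using hy)

/-- `e → 0` along this filter, so `e²` is `o(e)`; this absorbs the effect of centering. -/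
theorem isLittleO_of_sq_bound {α : Type*} {V : Set α} {e f : α → ℝ}
    (h : ∀ a ∈ V, |f a| ≤ e a ^ 2) : f =o[comap e (𝓝 0) ⊓ 𝓟 V] e := by
  have he : Tendsto e (comap e (𝓝 0) ⊓ 𝓟 V) (𝓝 0) := tendsto_comap.mono_left inf_le_left
  have h1 : (fun a => e a * e a) =o[comap e (𝓝 0) ⊓ 𝓟 V] e := by
    simpa using (isBigO_refl e _).mul_isLittleO ((isLittleO_one_iff ℝ).2 he)
  refine IsBigO.trans_isLittleO (IsBigO.of_bound 1 ?_) h1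
  rw [eventually_inf_principal]
  refine Eventually.of_forall fun a ha => ?_
  rw [one_mul, ← sq, Real.norm_eq_abs, Real.norm_of_nonneg (sq_nonneg _)]
  exact h a ha

theorem abs_sub_le_two_mul {x y z ε : ℝ} (hε : |ε| < 1) (h₁ : |y - z| ≤ |ε|)
    (h₂ : |x - y| ≤ ε ^ 2) : |x - z| ≤ 2 * |ε| := by
  have h3 : ε ^ 2 ≤ |ε| := by
    rw [← sq_abs]; nlinarith [abs_nonneg ε]
  have := abs_sub_le x y z
  linarith

/-- Linearization of PCA: `S` is the matrix decomposed, `S₀` a second order approximation. -/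
theorem pca_linearization {p : ℕ} {Sig Gam : Matrix (Fin p) (Fin p) ℝ} {lam : Fin p → ℝ}
    (hdec : IsSpectralDecomp Sig lam Gam) (hlam : StrictAnti lam) {η : ℝ} (hη : 0 < η) :
    ∃ δ > 0, ∀ (S S₀ G : Matrix (Fin p) (Fin p) ℝ) (l : Fin p → ℝ) (ε : ℝ),
      IsSpectralDecomp S l G → (∀ j, 0 ≤ G.col j ⬝ᵥ Gam.col j) →
      (∀ i j, |S₀ i j - Sig i j| ≤ |ε|) → (∀ i j, |S i j - S₀ i j| ≤ ε ^ 2) → |ε| < δ →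
      ‖betaVec l G - betaVec lam Gam - betaDeriv Sig lam Gam (S₀ - Sig)‖ ≤ η * |ε| := by
  -- A point of `α` is a full set of data and `V` collects the constraints. Expanding along `e → 0`
  -- within `V` makes the resulting `δ` uniform over all admissible data.
  let α := Matrix (Fin p) (Fin p) ℝ × Matrix (Fin p) (Fin p) ℝ × Matrix (Fin p) (Fin p) ℝ ×
    (Fin p → ℝ) × ℝ
  let V : Set α := {a | IsSpectralDecomp a.1 a.2.2.2.1 a.2.2.1 ∧
    (∀ j, 0 ≤ a.2.2.1.col j ⬝ᵥ Gam.col j) ∧ (∀ i j, |a.2.1 i j - Sig i j| ≤ |a.2.2.2.2|) ∧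
    ∀ i j, |a.1 i j - a.2.1 i j| ≤ a.2.2.2.2 ^ 2}
  let e : α → ℝ := fun a => a.2.2.2.2
  have hV : ∀ᶠ a in comap e (𝓝 0) ⊓ 𝓟 V, a ∈ V := mem_inf_of_right (mem_principal_self V)
  have he : Tendsto e (comap e (𝓝 0) ⊓ 𝓟 V) (𝓝 0) := tendsto_comap.mono_left inf_le_left
  have hS : ∀ i j, (fun a : α => a.1 i j - Sig i j) =O[comap e (𝓝 0) ⊓ 𝓟 V] e := fun i j =>
    isBigO_of_mem_constraint 2 fun a ha hea =>
      abs_sub_le_two_mul hea (ha.2.2.1 i j) (ha.2.2.2 i j)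
  have hconj := isBigO_conj (O := Gam) hS
  rw [hdec.conj_eq] at hconj
  obtain ⟨h1, h2, h3⟩ := spectralDecomp_expansion hlam he hconj
    (hV.mono fun a ha => ha.1.rotate hdec.orthogonal) (hV.mono fun a ha j => by
      have := ha.2.1 j
      rwa [dotProduct_comm] at this)
  have hsub (a : α) : Gamᵀ * a.1 * Gam - diagonal lam = Gamᵀ * (a.1 - Sig) * Gam := by
    rw [← hdec.conj_eq, Matrix.mul_sub, Matrix.sub_mul]
  simp only [hsub] at h1 h2
  have h4 := betaVec_isLittleO (E := fun a : α => a.1 - Sig) hdec h1 h2 h3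
  -- Replacing `S` by `S₀` in the linear term changes it only to second order.
  have h5 : (fun a : α => betaDeriv Sig lam Gam (a.1 - a.2.1)) =o[comap e (𝓝 0) ⊓ 𝓟 V] e :=
    betaDeriv_isLittleO Sig Gam lam fun i j => isLittleO_of_sq_bound fun a ha => ha.2.2.2 i j
  obtain ⟨δ, hδ, hmain⟩ := exists_delta_of_isLittleO (h4.add h5) hη
  refine ⟨δ, hδ, fun S S₀ G l ε h1 h2 h3 h4 h5 => ?_⟩
  have := hmain (S, S₀, G, l, ε) ⟨h1, h2, h3, h4⟩ h5
  refine le_of_eq_of_le ?_ this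
  congr 1
  simp only [map_sub]
  abel

/-- Linearization of product-PCA: `S₁`, `S₂` are the two covariance matrices, `R₁`, `R₂` second
order approximations. -/
theorem ppca_linearization {p : ℕ} {Sig Gam : Matrix (Fin p) (Fin p) ℝ} {lam : Fin p → ℝ}
    (hdec : IsSpectralDecomp Sig lam Gam) (hlam : StrictAnti lam) (hnn : ∀ i, 0 ≤ lam i)
    {η : ℝ} (hη : 0 < η) :
    ∃ δ > 0, ∀ (S₁ S₂ R₁ R₂ G : Matrix (Fin p) (Fin p) ℝ) (l : Fin p → ℝ) (ε : ℝ),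
      S₁.PosSemidef → S₂.PosSemidef →
      (∀ j, lam j = 0 → (Gamᵀ * S₁ * Gam) j j = 0) →
      (∀ j, lam j = 0 → (Gamᵀ * S₂ * Gam) j j = 0) →
      IsPPCA S₁ S₂ l G → (∀ j, 0 ≤ G.col j ⬝ᵥ Gam.col j) →
      (∀ i j, |R₁ i j - Sig i j| ≤ |ε|) → (∀ i j, |R₂ i j - Sig i j| ≤ |ε|) →
      (∀ i j, |S₁ i j - R₁ i j| ≤ ε ^ 2) → (∀ i j, |S₂ i j - R₂ i j| ≤ ε ^ 2) → |ε| < δ →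
      ‖betaVec l G - betaVec lam Gam -
        betaDeriv Sig lam Gam ((2 : ℝ)⁻¹ • (R₁ + R₂) - Sig)‖ ≤ η * |ε| := by
  -- The singular vectors belong to the tuple because `IsPPCA` only asserts their existence.
  let α := Matrix (Fin p) (Fin p) ℝ × Matrix (Fin p) (Fin p) ℝ × Matrix (Fin p) (Fin p) ℝ ×
    Matrix (Fin p) (Fin p) ℝ × Matrix (Fin p) (Fin p) ℝ × Matrix (Fin p) (Fin p) ℝ ×
    Matrix (Fin p) (Fin p) ℝ × (Fin p → ℝ) × ℝ
  let s₁ : α → Matrix (Fin p) (Fin p) ℝ := fun a => a.1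
  let s₂ : α → Matrix (Fin p) (Fin p) ℝ := fun a => a.2.1
  let r₁ : α → Matrix (Fin p) (Fin p) ℝ := fun a => a.2.2.1
  let r₂ : α → Matrix (Fin p) (Fin p) ℝ := fun a => a.2.2.2.1
  let g : α → Matrix (Fin p) (Fin p) ℝ := fun a => a.2.2.2.2.1
  let u : α → Matrix (Fin p) (Fin p) ℝ := fun a => a.2.2.2.2.2.1
  let v : α → Matrix (Fin p) (Fin p) ℝ := fun a => a.2.2.2.2.2.2.1
  let lh : α → Fin p → ℝ := fun a => a.2.2.2.2.2.2.2.1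
  let e : α → ℝ := fun a => a.2.2.2.2.2.2.2.2
  let V : Set α := {a | ((s₁ a).PosSemidef ∧ (s₂ a).PosSemidef) ∧
    ((∀ j, lam j = 0 → (Gamᵀ * s₁ a * Gam) j j = 0) ∧
      ∀ j, lam j = 0 → (Gamᵀ * s₂ a * Gam) j j = 0) ∧
    IsSVD (psdSqrt (s₁ a) * psdSqrt (s₂ a)) (u a) (lh a) (v a) ∧
    (∀ j, IsFirstEigenvector (vecMulVec ((u a).col j) ((u a).col j) +
      vecMulVec ((v a).col j) ((v a).col j)) ((g a).col j)) ∧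
    (∀ j, 0 ≤ (g a).col j ⬝ᵥ Gam.col j) ∧
    ((∀ i j, |r₁ a i j - Sig i j| ≤ |e a|) ∧ ∀ i j, |r₂ a i j - Sig i j| ≤ |e a|) ∧
    (∀ i j, |s₁ a i j - r₁ a i j| ≤ e a ^ 2) ∧ ∀ i j, |s₂ a i j - r₂ a i j| ≤ e a ^ 2}
  have hO := hdec.orthogonal
  have hV : ∀ᶠ a in comap e (𝓝 0) ⊓ 𝓟 V, a ∈ V := mem_inf_of_right (mem_principal_self V)
  have he : Tendsto e (comap e (𝓝 0) ⊓ 𝓟 V) (𝓝 0) := tendsto_comap.mono_left inf_le_left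
  have hS₁ : ∀ i j, (fun a : α => s₁ a i j - Sig i j) =O[comap e (𝓝 0) ⊓ 𝓟 V] e := fun i j =>
    isBigO_of_mem_constraint 2 fun a ha hea =>
      abs_sub_le_two_mul hea (ha.2.2.2.2.2.1.1 i j) (ha.2.2.2.2.2.2.1 i j)
  have hS₂ : ∀ i j, (fun a : α => s₂ a i j - Sig i j) =O[comap e (𝓝 0) ⊓ 𝓟 V] e := fun i j =>
    isBigO_of_mem_constraint 2 fun a ha hea =>
      abs_sub_le_two_mul hea (ha.2.2.2.2.2.1.2 i j) (ha.2.2.2.2.2.2.2 i j)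
  have hc₁ := isBigO_conj (O := Gam) hS₁
  have hc₂ := isBigO_conj (O := Gam) hS₂
  rw [hdec.conj_eq] at hc₁ hc₂
  obtain ⟨h1, h2, h3⟩ := ppca_expansion (G := fun a => Gamᵀ * g a)
    (U := fun a => Gamᵀ * u a) (V := fun a => Gamᵀ * v a) (l := lh) hlam hnn he hc₁ hc₂
    (hV.mono fun a ha => ha.2.1.1) (hV.mono fun a ha => ha.2.1.2)
    (hV.mono fun a ha => psdSqrt_rotate ha.1.1 hO) (hV.mono fun a ha => psdSqrt_rotate ha.1.2 hO)
    (hV.mono fun a ha => by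
      have h0 := ha.2.2.1.rotate hO
      have h1 : Gamᵀ * psdSqrt (s₁ a) * Gam * (Gamᵀ * psdSqrt (s₂ a) * Gam) =
          Gamᵀ * (psdSqrt (s₁ a) * psdSqrt (s₂ a)) * Gam := by
        calc _ = Gamᵀ * psdSqrt (s₁ a) * (Gam * Gamᵀ) * psdSqrt (s₂ a) * Gam := by
              simp only [Matrix.mul_assoc]
          _ = _ := by
              rw [orthogonal_mul_transpose hO, Matrix.mul_one]; simp only [Matrix.mul_assoc]
      rwa [h1])
    (hV.mono fun a ha j => by
      have h0 := (ha.2.2.2.1 j).rotate hO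
      rw [Matrix.mul_add, Matrix.add_mul, ← vecMulVec_rotate, ← vecMulVec_rotate] at h0
      simpa only [col_transpose_mul] using h0)
    (hV.mono fun a ha j => by
      have := ha.2.2.2.2.1 j
      rwa [dotProduct_comm] at this)
  have hsub (a : α) : (2 : ℝ)⁻¹ • (Gamᵀ * s₁ a * Gam - diagonal lam +
      (Gamᵀ * s₂ a * Gam - diagonal lam)) =
      Gamᵀ * ((2 : ℝ)⁻¹ • (s₁ a - Sig + (s₂ a - Sig))) * Gam := by
    rw [← hdec.conj_eq]
    simp only [Matrix.mul_smul, Matrix.smul_mul, Matrix.mul_sub, Matrix.sub_mul, Matrix.mul_add,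
      Matrix.add_mul]
  simp only [hsub] at h1 h2
  have h4 := betaVec_isLittleO hdec h1 h2 h3
  have h5 : (fun a : α => betaDeriv Sig lam Gam
      ((2 : ℝ)⁻¹ • (s₁ a - r₁ a + (s₂ a - r₂ a)))) =o[comap e (𝓝 0) ⊓ 𝓟 V] e :=
    betaDeriv_isLittleO Sig Gam lam fun i j => IsLittleO.const_mul_left (IsLittleO.add
      (isLittleO_of_sq_bound fun a ha => ha.2.2.2.2.2.2.1 i j)
      (isLittleO_of_sq_bound fun a ha => ha.2.2.2.2.2.2.2 i j)) _
  obtain ⟨δ, hδ, hmain⟩ := exists_delta_of_isLittleO (h4.add h5) hη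
  refine ⟨δ, hδ, fun S₁ S₂ R₁ R₂ G l ε p1 p2 k1 k2 hp hs b1 b2 c1 c2 h => ?_⟩
  obtain ⟨U', V', hsvd, hfe⟩ := hp
  have := hmain (S₁, S₂, R₁, R₂, G, U', V', l, ε)
    ⟨⟨p1, p2⟩, ⟨k1, k2⟩, hsvd, hfe, hs, ⟨b1, b2⟩, c1, c2⟩ h
  refine le_of_eq_of_le ?_ this
  congr 1
  have e1 : (2 : ℝ)⁻¹ • (S₁ - Sig + (S₂ - Sig)) - (2 : ℝ)⁻¹ • (S₁ - R₁ + (S₂ - R₂)) =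
      (2 : ℝ)⁻¹ • (R₁ + R₂) - Sig := by
    have e2 : Sig = (2 : ℝ)⁻¹ • (Sig + Sig) := by
      rw [← two_smul ℝ Sig, smul_smul]; norm_num
    conv_rhs => rw [e2]
    rw [← smul_sub, ← smul_sub]
    congr 1
    abel
  rw [← e1, map_sub]
  simp only [s₁, s₂, r₁, r₂, g, lh]
  abel

/-! ### Central limit theorem, tail bounds and negligible remainders -/

section Probability

variable {Ω : Type*} [MeasurableSpace Ω] {P : Measure Ω} [IsProbabilityMeasure P]

theorem variance_sum_mul_eq {ι : Type*} [Fintype ι] {Y : Ω → ι → ℝ}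
    (hY : ∀ c, MemLp (fun ω => Y ω c) 2 P) (t : ι → ℝ) :
    Var[fun ω => ∑ c, t c * Y ω c; P] = t ⬝ᵥ covMat P Y *ᵥ t := by
  have hm : AEMeasurable (fun ω => ∑ c, t c * Y ω c) P :=
    (memLp_finsetSum _ fun c _ => (hY c).const_mul (t c)).aemeasurable
  rw [← covariance_self hm, covariance_fun_sum_fun_sum (fun c => (hY c).const_mul (t c))
    fun c => (hY c).const_mul (t c)]
  simp only [covariance_const_mul_left, covariance_const_mul_right, dotProduct, mulVec, covMat,
    of_apply, Finset.mul_sum]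
  exact Finset.sum_congr rfl fun c _ => Finset.sum_congr rfl fun d _ => by ring

theorem covMat_posSemidef {ι : Type*} [Fintype ι] {Y : Ω → ι → ℝ}
    (hY : ∀ c, MemLp (fun ω => Y ω c) 2 P) : (covMat P Y).PosSemidef := by
  refine Matrix.PosSemidef.of_dotProduct_mulVec_nonneg ?_ fun t => ?_
  · ext a b
    simp only [conjTranspose_apply, covMat, of_apply, star_trivial]
    exact covariance_comm _ _
  · rw [star_trivial, ← variance_sum_mul_eq hY]
    exact variance_nonneg _ _

theorem covMat_transpose_mulVec {ι κ : Type*} [Fintype ι] {Y : Ω → ι → ℝ}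
    (hY : ∀ c, MemLp (fun ω => Y ω c) 2 P) (H : Matrix ι κ ℝ) :
    covMat P (fun ω => Hᵀ *ᵥ Y ω) = Hᵀ * covMat P Y * H := by
  ext a b
  have h1 := covariance_fun_sum_fun_sum (μ := P) (fun c => (hY c).const_mul (H c a))
    fun c => (hY c).const_mul (H c b)
  simp only [covariance_const_mul_left, covariance_const_mul_right] at h1
  simp only [covMat, of_apply, mulVec, dotProduct, transpose_apply, Matrix.mul_apply, h1,
    Finset.sum_mul]
  rw [Finset.sum_comm]
  exact Finset.sum_congr rfl fun c _ => Finset.sum_congr rfl fun d _ => by ring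

omit [IsProbabilityMeasure P] in
-- The Cramér–Wold device: a characteristic function is read off from one-dimensional projections.
theorem charFun_map_eq_charFun_map_inner {E : Type*} [NormedAddCommGroup E]
    [InnerProductSpace ℝ E] [MeasurableSpace E] [BorelSpace E] [SecondCountableTopology E]
    {Y : Ω → E} (hY : AEMeasurable Y P) (t : E) :
    charFun (P.map Y) t = charFun (P.map fun ω => inner ℝ (Y ω) t) 1 := by
  rw [charFun_apply, charFun_apply, integral_map hY (by fun_prop),
    integral_map (by fun_prop) (by fun_prop)]
  simp

/-- The central limit theorem in `EuclideanSpace ℝ ι`. -/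
theorem tendstoInDistribution_multivariateGaussian {ι : Type*} [Fintype ι] [DecidableEq ι]
    {Z : ℕ → Ω → EuclideanSpace ℝ ι} (hZ : ∀ i, Measurable (Z i)) (hindep : iIndepFun Z P)
    (hident : ∀ i, IdentDistrib (Z i) (Z 0) P P) (hL2 : ∀ c, MemLp (fun ω => Z 0 ω c) 2 P)
    {m : EuclideanSpace ℝ ι} (hm : ∀ c, ∫ ω, Z 0 ω c ∂P = m c) :
    TendstoInDistribution
      (fun (n : ℕ) ω => (√(n : ℝ))⁻¹ • (∑ i ∈ Finset.range n, Z i ω - (n : ℝ) • m))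
      atTop id (fun _ => P) (multivariateGaussian 0 (covMat P fun ω c => Z 0 ω c)) := by
  have hmeas (n : ℕ) : Measurable
      fun ω => (√(n : ℝ))⁻¹ • (∑ i ∈ Finset.range n, Z i ω - (n : ℝ) • m) := by fun_prop
  refine ⟨fun n => (hmeas n).aemeasurable, aemeasurable_id, ?_⟩
  refine ProbabilityMeasure.tendsto_iff_tendsto_charFun.2 fun t => ?_
  have hg : Measurable fun x : EuclideanSpace ℝ ι => inner ℝ x t := by fun_prop
  have hin (x : EuclideanSpace ℝ ι) : inner ℝ x t = ∑ c, t c * x c := by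
    simp [PiLp.inner_apply]
  have hL : MemLp (fun ω => inner ℝ (Z 0 ω) t) 2 P := by
    simp only [hin]
    exact memLp_finsetSum _ fun c _ => (hL2 c).const_mul (t c)
  have hmean : ∫ ω, inner ℝ (Z 0 ω) t ∂P = inner ℝ m t := by
    simp only [hin]
    rw [integral_finsetSum _ fun c _ =>
      ((hL2 c).integrable (by norm_num)).const_mul (t c)]
    simp only [integral_const_mul, hm]
  -- The scalar theorem for the projections has limit variance `tᵀ Cov t`, the quadratic form in the
  -- multivariate Gaussian characteristic function.
  have hclt := tendstoInDistribution_inv_sqrt_mul_sum_sub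
    (X := fun i ω => inner ℝ (Z i ω) t) (P := P) HasLaw.id hL
    (hindep.comp (fun _ => fun x => inner ℝ x t) fun _ => hg) fun i => (hident i).comp hg
  have hc := ProbabilityMeasure.tendsto_iff_tendsto_charFun.1 hclt.tendsto 1
  simp only [ProbabilityMeasure.coe_mk, Measure.map_id] at hc ⊢
  have hvar : Var[fun ω => inner ℝ (Z 0 ω) t; P] =
      t ⬝ᵥ (covMat P fun ω c => Z 0 ω c) *ᵥ t := by
    rw [← variance_sum_mul_eq hL2]
    simp only [hin]
  have hlim : charFun (gaussianReal 0 Var[fun ω => inner ℝ (Z 0 ω) t; P].toNNReal) 1 =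
      charFun (multivariateGaussian 0 (covMat P fun ω c => Z 0 ω c)) t := by
    rw [charFun_gaussianReal, charFun_multivariateGaussian (covMat_posSemidef hL2),
      Real.coe_toNNReal _ (variance_nonneg _ _), hvar]
    simp
  rw [hlim] at hc
  refine hc.congr fun n => ?_
  rw [charFun_map_eq_charFun_map_inner (hmeas n).aemeasurable]
  congr 2
  ext ω
  rw [real_inner_smul_left, inner_sub_left, real_inner_smul_left, sum_inner, hmean]

/-- Chebyshev's inequality for the mean of i.i.d. centered square integrable variables. -/
theorem measure_abs_mean_ge_le {Y : ℕ → Ω → ℝ} (hindep : iIndepFun Y P)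
    (hident : ∀ i, IdentDistrib (Y i) (Y 0) P P) (hL2 : MemLp (Y 0) 2 P)
    (hmean : ∫ ω, Y 0 ω ∂P = 0) (s : Finset ℕ) (hs : 0 < s.card) {c : ℝ} (hc : 0 < c) :
    P {ω | c ≤ |(s.card : ℝ)⁻¹ * ∑ i ∈ s, Y i ω|} ≤
      ENNReal.ofReal (Var[Y 0; P] / (s.card * c ^ 2)) := by
  have hL (i : ℕ) : MemLp (Y i) 2 P := (hident i).memLp_iff.2 hL2
  have hs' : (0 : ℝ) < s.card := by exact_mod_cast hs
  have hLs : MemLp (∑ i ∈ s, Y i) 2 P := memLp_finsetSum' _ fun i _ => hL i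
  have hint : ∫ ω, (∑ i ∈ s, Y i) ω ∂P = 0 := by
    simp only [Finset.sum_apply]
    rw [integral_finsetSum _ fun i _ => (hL i).integrable (by norm_num)]
    exact Finset.sum_eq_zero fun i _ => by rw [(hident i).integral_eq, hmean]
  have hvar : Var[∑ i ∈ s, Y i; P] = s.card * Var[Y 0; P] := by
    rw [IndepFun.variance_sum (fun i _ => hL i) fun i _ j _ hij => hindep.indepFun hij,
      Finset.sum_congr rfl fun i _ => (hident i).variance_eq]
    simp
  have h1 := meas_ge_le_variance_div_sq hLs (c := s.card * c) (by positivity)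
  rw [hint, hvar] at h1
  have e1 : (s.card : ℝ) * Var[Y 0; P] / (s.card * c) ^ 2 = Var[Y 0; P] / (s.card * c ^ 2) := by
    field_simp
  rw [e1] at h1
  refine le_of_eq_of_le ?_ h1
  congr 1
  ext ω
  simp only [Set.mem_ofPred_eq, sub_zero, Finset.sum_apply, abs_mul, abs_inv, Nat.abs_cast]
  rw [le_inv_mul_iff₀ hs']

/-- The sum of the absolute means of finitely many functions over a sample. -/
noncomputable def sumAbsMean {κ E : Type*} [Fintype κ] (φ : κ → E → ℝ) (s : Finset ℕ)
    (x : ℕ → E) : ℝ :=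
  ∑ k, |(s.card : ℝ)⁻¹ * ∑ i ∈ s, φ k (x i)|

theorem sumAbsMean_nonneg {κ E : Type*} [Fintype κ] (φ : κ → E → ℝ) (s : Finset ℕ)
    (x : ℕ → E) : 0 ≤ sumAbsMean φ s x := Finset.sum_nonneg fun _ _ => abs_nonneg _

theorem abs_mean_le_sumAbsMean {κ E : Type*} [Fintype κ] (φ : κ → E → ℝ) (s : Finset ℕ)
    (x : ℕ → E) (k : κ) : |(s.card : ℝ)⁻¹ * ∑ i ∈ s, φ k (x i)| ≤ sumAbsMean φ s x :=
  Finset.single_le_sum (f := fun k => |(s.card : ℝ)⁻¹ * ∑ i ∈ s, φ k (x i)|)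
    (fun _ _ => abs_nonneg _) (Finset.mem_univ k)

/-- Union bound and Chebyshev. That `C` does not depend on `s` is what makes the bound usable for
random index sets. -/
theorem exists_measure_sumAbsMean_ge_le {κ E : Type*} [Fintype κ] [MeasurableSpace E]
    {X : ℕ → Ω → E} (hindep : iIndepFun X P) (hident : ∀ i, IdentDistrib (X i) (X 0) P P)
    {φ : κ → E → ℝ} (hφ : ∀ k, Measurable (φ k)) (hL2 : ∀ k, MemLp (fun ω => φ k (X 0 ω)) 2 P)
    (hmean : ∀ k, ∫ ω, φ k (X 0 ω) ∂P = 0) :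
    ∃ C : ℝ, ∀ s : Finset ℕ, 0 < s.card → ∀ c : ℝ, 0 < c →
      P {ω | c ≤ sumAbsMean φ s fun i => X i ω} ≤ ENNReal.ofReal (C / (s.card * c ^ 2)) := by
  -- The extra `1` keeps `K` positive for empty `κ` and makes `card κ * (c / K) < c` strict.
  set K : ℝ := Fintype.card κ + 1 with hK
  have hK0 : 0 < K := by positivity
  refine ⟨∑ k, Var[fun ω => φ k (X 0 ω); P] * K ^ 2, fun s hs c hc => ?_⟩
  have hs' : (0 : ℝ) < s.card := by exact_mod_cast hs
  have hsub : {ω | c ≤ sumAbsMean φ s fun i => X i ω} ⊆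
      ⋃ k ∈ (Finset.univ : Finset κ),
        {ω | c / K ≤ |(s.card : ℝ)⁻¹ * ∑ i ∈ s, φ k (X i ω)|} := by
    intro ω hω
    by_contra hcon
    simp only [Finset.mem_univ, Set.iUnion_true, Set.mem_iUnion, Set.mem_ofPred_eq, not_exists,
      not_le] at hcon hω
    have h1 : sumAbsMean φ s (fun i => X i ω) ≤ ∑ _k : κ, c / K :=
      Finset.sum_le_sum fun k _ => (hcon k).le
    rw [Finset.sum_const, Finset.card_univ, nsmul_eq_mul] at h1
    have h2 : (Fintype.card κ : ℝ) * (c / K) < c := by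
      rw [mul_div_assoc', div_lt_iff₀ hK0, hK]
      nlinarith
    linarith
  calc P {ω | c ≤ sumAbsMean φ s fun i => X i ω}
      ≤ ∑ k, P {ω | c / K ≤ |(s.card : ℝ)⁻¹ * ∑ i ∈ s, φ k (X i ω)|} :=
        (measure_mono hsub).trans (measure_biUnion_finset_le _ _)
    _ ≤ ∑ k, ENNReal.ofReal (Var[fun ω => φ k (X 0 ω); P] * K ^ 2 / (s.card * c ^ 2)) := by
        refine Finset.sum_le_sum fun k _ => ?_
        have := measure_abs_mean_ge_le (Y := fun i ω => φ k (X i ω)) (P := P)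
          (hindep.comp (fun _ => φ k) fun _ => hφ k) (fun i => (hident i).comp (hφ k)) (hL2 k)
          (hmean k) s hs (div_pos hc hK0)
        refine this.trans (le_of_eq ?_)
        congr 1
        field_simp
    _ = _ := by
        rw [← ENNReal.ofReal_sum_of_nonneg fun k _ => by
          have := variance_nonneg (fun ω => φ k (X 0 ω)) P
          positivity, Finset.sum_div]

/-- A tail bound uniform over fixed index sets holds for a random index set that is independent
of the data. -/
theorem measure_sumAbsMean_random_ge_le {κ E : Type*} [Fintype κ] [MeasurableSpace E] [Zero E]
    {X : ℕ → Ω → E} {φ : κ → E → ℝ} (hφ : ∀ k, Measurable (φ k)) {N m : ℕ}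
    {A : Ω → Finset ℕ} (hA : Measurable[_, ⊤] A)
    (hAN : ∀ ω, A ω ⊆ Finset.range N ∧ (A ω).card = m)
    (hind : Indep (MeasurableSpace.comap A ⊤)
      (MeasurableSpace.comap (fun ω (i : Fin N) => X i ω) inferInstance) P)
    {g : Finset ℕ → Finset ℕ} (hg : ∀ a ⊆ Finset.range N, g a ⊆ Finset.range N)
    {c : ℝ} {b : ENNReal}
    (hb : ∀ a ⊆ Finset.range N, a.card = m → P {ω | c ≤ sumAbsMean φ (g a) fun i => X i ω} ≤ b) :
    P {ω | c ≤ sumAbsMean φ (g (A ω)) fun i => X i ω} ≤ b := by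
  classical
  set T := (Finset.range N).powerset.filter fun a => a.card = m with hT
  have hmT (a : Finset ℕ) : a ∈ T ↔ a ⊆ Finset.range N ∧ a.card = m := by
    rw [hT, Finset.mem_filter, Finset.mem_powerset]
  have hsub : {ω | c ≤ sumAbsMean φ (g (A ω)) fun i => X i ω} ⊆
      ⋃ a ∈ T, (A ⁻¹' {a} ∩ {ω | c ≤ sumAbsMean φ (g a) fun i => X i ω}) := by
    intro ω hω
    simp only [Set.mem_iUnion]
    exact ⟨A ω, (hmT _).2 (hAN ω), rfl, hω⟩
  have hprod (a : Finset ℕ) (ha : a ∈ T) :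
      P (A ⁻¹' {a} ∩ {ω | c ≤ sumAbsMean φ (g a) fun i => X i ω}) =
        P (A ⁻¹' {a}) * P {ω | c ≤ sumAbsMean φ (g a) fun i => X i ω} := by
    refine (Indep_iff _ _ _).1 hind _ _ ⟨{a}, trivial, rfl⟩ ?_
    -- Independence concerns the first `N` observations, so the event is written through them; the
    -- padding by `0` is never read, as `g a ⊆ Finset.range N`.
    let ext : (Fin N → E) → ℕ → E := fun y i => if h : i < N then y ⟨i, h⟩ else 0
    refine ⟨{y | c ≤ sumAbsMean φ (g a) (ext y)}, ?_, ?_⟩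
    · have hext (i : ℕ) : Measurable fun y => ext y i := by
        by_cases h : i < N
        · simpa only [ext, h, dite_true] using measurable_pi_apply _
        · simpa only [ext, h, dite_false] using measurable_const
      refine measurableSet_le measurable_const ?_
      unfold sumAbsMean
      refine Finset.measurable_sum _ fun k _ => Measurable.abs (Measurable.const_mul ?_ _)
      exact Finset.measurable_sum _ fun i _ => (hφ k).comp (hext i)
    · have hga := hg a ((hmT a).1 ha).1
      ext ω
      have : sumAbsMean φ (g a) (ext fun i => X i ω) = sumAbsMean φ (g a) fun i => X i ω := by
        unfold sumAbsMean
        refine Finset.sum_congr rfl fun k _ => ?_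
        congr 2
        refine Finset.sum_congr rfl fun i hi => ?_
        have := Finset.mem_range.1 (hga hi)
        simp only [ext, this, dite_true]
      simp only [Set.mem_preimage, Set.mem_ofPred_eq, this]
  calc P {ω | c ≤ sumAbsMean φ (g (A ω)) fun i => X i ω}
      ≤ ∑ a ∈ T, P (A ⁻¹' {a} ∩ {ω | c ≤ sumAbsMean φ (g a) fun i => X i ω}) :=
        (measure_mono hsub).trans (measure_biUnion_finset_le _ _)
    _ ≤ ∑ a ∈ T, P (A ⁻¹' {a}) * b := by
        refine Finset.sum_le_sum fun a ha => ?_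
        rw [hprod a ha]
        gcongr
        exact hb a ((hmT a).1 ha).1 ((hmT a).1 ha).2
    _ = P (⋃ a ∈ T, A ⁻¹' {a}) * b := by
        rw [← Finset.sum_mul, measure_biUnion_finset]
        · intro a _ a' _ haa
          exact Disjoint.preimage _ (Set.disjoint_singleton.2 haa)
        · exact fun a _ => hA trivial
    _ ≤ 1 * b := by gcongr; exact prob_le_one
    _ = b := one_mul b

omit [IsProbabilityMeasure P] in
/-- A linearization error that is `o(ε)` with `ε = O_p(N^{-1/2})` is `o_p(N^{-1/2})`. -/
theorem tendsto_measure_of_linearization {E : Type*} [NormedAddCommGroup E] [NormedSpace ℝ E]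
    {Δ : ℕ → Ω → E} {ε : ℕ → Ω → ℝ} {N : ℕ → ℕ} {B : ℕ → Set Ω} {C : ℝ}
    (hlin : ∀ η > 0, ∃ δ > 0, ∀ᶠ n in atTop, ∀ᵐ ω ∂P, ω ∉ B n → ε n ω < δ →
      ‖Δ n ω‖ ≤ η * ε n ω)
    (hB : Tendsto (fun n => P (B n)) atTop (𝓝 0)) (hN : Tendsto N atTop atTop)
    (htight : ∀ᶠ n in atTop, ∀ c > 0, P {ω | c ≤ ε n ω} ≤ ENNReal.ofReal (C / (N n * c ^ 2)))
    {κ : ℝ} (hκ : 0 < κ) :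
    Tendsto (fun n => P {ω | κ ≤ ‖√(N n : ℝ) • Δ n ω‖}) atTop (𝓝 0) := by
  have hNr : Tendsto (fun n => (N n : ℝ)) atTop atTop := tendsto_natCast_atTop_atTop.comp hN
  rw [ENNReal.tendsto_nhds_zero]
  intro θ hθ
  obtain ⟨θ', hθ'0, hθ'⟩ := ENNReal.lt_iff_exists_nnreal_btwn.1 hθ
  have ht : (0 : ℝ) < θ' := by exact_mod_cast hθ'0
  -- Off the exceptional sets, a scaled remainder of size `κ` forces `ε ≥ κ / (√N η)`. The tail
  -- bound for this event is `C η² / κ²`, free of `N`, so `η` is fixed first.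
  obtain ⟨η, hη, hηC⟩ : ∃ η > 0, |C| * η ^ 2 / κ ^ 2 ≤ θ' / 3 := by
    have h1 : Tendsto (fun η : ℝ => |C| * η ^ 2 / κ ^ 2) (𝓝[>] 0) (𝓝 0) := by
      have : Continuous fun η : ℝ => |C| * η ^ 2 / κ ^ 2 := by fun_prop
      have := (this.tendsto 0).mono_left (nhdsWithin_le_nhds (s := Set.Ioi 0))
      simpa using this
    obtain ⟨η, h2, h3⟩ := ((h1.eventually_le_const (by positivity : (0 : ℝ) < θ' / 3)).and
      self_mem_nhdsWithin).exists
    exact ⟨η, h3, h2⟩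
  obtain ⟨δ, hδ, hlin⟩ := hlin η hη
  have hδlim : Tendsto (fun n => C / (N n * δ ^ 2)) atTop (𝓝 0) :=
    tendsto_const_nhds.div_atTop (hNr.atTop_mul_const (by positivity))
  have hBe := (ENNReal.tendsto_nhds_zero.1 hB) (ENNReal.ofReal (θ' / 3))
    (ENNReal.ofReal_pos.2 (by positivity))
  filter_upwards [hlin, hBe, htight, hNr.eventually_gt_atTop 0,
    hδlim.eventually_le_const (by positivity : (0 : ℝ) < θ' / 3)] with n h1 h2 h3 h4 h5
  have hsq : 0 < √(N n : ℝ) := Real.sqrt_pos.2 h4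
  have hsub : P {ω | κ ≤ ‖√(N n : ℝ) • Δ n ω‖} ≤
      P (B n ∪ ({ω | δ ≤ ε n ω} ∪ {ω | κ / (√(N n : ℝ) * η) ≤ ε n ω})) := by
    refine measure_mono_ae ?_
    filter_upwards [h1] with ω hω hmem
    change κ ≤ ‖√(N n : ℝ) • Δ n ω‖ at hmem
    change ω ∈ B n ∪ ({ω | δ ≤ ε n ω} ∪ {ω | κ / (√(N n : ℝ) * η) ≤ ε n ω})
    by_contra hcon
    simp only [Set.mem_union, Set.mem_ofPred_eq, not_or, not_le] at hcon
    obtain ⟨c1, c2, c3⟩ := hcon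
    have h6 := hω c1 c2
    rw [norm_smul, Real.norm_of_nonneg hsq.le] at hmem
    rw [lt_div_iff₀ (by positivity)] at c3
    have h7 : √(N n : ℝ) * ‖Δ n ω‖ ≤ √(N n : ℝ) * (η * ε n ω) := by gcongr
    linarith
  refine hsub.trans (((measure_union_le _ _).trans (add_le_add_right (measure_union_le _ _) _)).trans
    (le_trans ?_ hθ'.le))
  have e2 : P {ω | δ ≤ ε n ω} ≤ ENNReal.ofReal (θ' / 3) :=
    (h3 δ hδ).trans (ENNReal.ofReal_le_ofReal h5)
  have e3 : P {ω | κ / (√(N n : ℝ) * η) ≤ ε n ω} ≤ ENNReal.ofReal (θ' / 3) := by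
    refine (h3 _ (by positivity)).trans (ENNReal.ofReal_le_ofReal (le_trans ?_ hηC))
    rw [div_pow, mul_pow, Real.sq_sqrt h4.le]
    have : C / (N n * (κ ^ 2 / (N n * η ^ 2))) = C * η ^ 2 / κ ^ 2 := by
      field_simp
    rw [this]
    gcongr
    exact le_abs_self C
  calc P (B n) + (P {ω | δ ≤ ε n ω} + P {ω | κ / (√(N n : ℝ) * η) ≤ ε n ω})
      ≤ ENNReal.ofReal (θ' / 3) + (ENNReal.ofReal (θ' / 3) + ENNReal.ofReal (θ' / 3)) :=
        add_le_add h2 (add_le_add e2 e3)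
    _ = ENNReal.ofReal θ' := by
        rw [← ENNReal.ofReal_add (by positivity) (by positivity),
          ← ENNReal.ofReal_add (by positivity) (by positivity)]
        congr 1
        ring
    _ = θ' := by rw [ENNReal.ofReal_coe_nnreal]

end Probability

/-! ### Sample covariance matrices -/

section SampleCov

variable {p : ℕ}

/-- The centered second moments and the coordinates. -/
def momentFun (Sig : Matrix (Fin p) (Fin p) ℝ) :
    (Fin p × Fin p) ⊕ Fin p → (Fin p → ℝ) → ℝ :=
  Sum.elim (fun ab x => x ab.1 * x ab.2 - Sig ab.1 ab.2) fun a x => x a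

theorem sampleCov_false_apply (s : Finset ℕ) (x : ℕ → Fin p → ℝ) (a b : Fin p) :
    sampleCov false s x a b = (s.card : ℝ)⁻¹ * ∑ i ∈ s, x i a * x i b := by
  simp [sampleCov, Matrix.sum_apply, vecMulVec_apply]

theorem sampleCov_true_apply (s : Finset ℕ) (x : ℕ → Fin p → ℝ) (a b : Fin p) :
    sampleCov true s x a b = sampleCov false s x a b -
      ((s.card : ℝ)⁻¹ * ∑ i ∈ s, x i a) * ((s.card : ℝ)⁻¹ * ∑ i ∈ s, x i b) := by
  rcases s.eq_empty_or_nonempty with rfl | hs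
  · simp [sampleCov]
  have hc : (s.card : ℝ) ≠ 0 := by exact_mod_cast hs.card_pos.ne'
  rw [sampleCov_false_apply]
  simp only [sampleCov, if_true, Matrix.smul_apply, Matrix.sum_apply, vecMulVec_apply,
    Pi.sub_apply, Pi.smul_apply, Finset.sum_apply, smul_eq_mul, sub_mul, mul_sub,
    Finset.sum_sub_distrib, ← Finset.mul_sum, ← Finset.sum_mul, Finset.sum_const, nsmul_eq_mul]
  field_simp
  ring

theorem abs_sampleCov_false_sub_le (Sig : Matrix (Fin p) (Fin p) ℝ) {s : Finset ℕ}
    (hs : 0 < s.card) (x : ℕ → Fin p → ℝ) (a b : Fin p) :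
    |sampleCov false s x a b - Sig a b| ≤ sumAbsMean (momentFun Sig) s x := by
  refine le_of_eq_of_le ?_ (abs_mean_le_sumAbsMean (momentFun Sig) s x (Sum.inl (a, b)))
  have hc : (s.card : ℝ) ≠ 0 := by exact_mod_cast hs.ne'
  rw [sampleCov_false_apply]
  simp only [momentFun, Sum.elim_inl, Finset.sum_sub_distrib, Finset.sum_const, nsmul_eq_mul,
    mul_sub, inv_mul_cancel_left₀ hc]

/-- Centering subtracts a product of two sample means, each controlled by the first order error. -/
theorem abs_sampleCov_sub_le (Sig : Matrix (Fin p) (Fin p) ℝ) (centered : Bool) (s : Finset ℕ)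
    (x : ℕ → Fin p → ℝ) (a b : Fin p) :
    |sampleCov centered s x a b - sampleCov false s x a b| ≤
      sumAbsMean (momentFun Sig) s x ^ 2 := by
  cases centered with
  | false => simpa using sq_nonneg _
  | true =>
    rw [sampleCov_true_apply, sub_sub_cancel_left, abs_neg, abs_mul, sq]
    exact mul_le_mul (abs_mean_le_sumAbsMean (momentFun Sig) s x (Sum.inr a))
      (abs_mean_le_sumAbsMean (momentFun Sig) s x (Sum.inr b)) (abs_nonneg _)
      (sumAbsMean_nonneg _ _ _)

theorem sampleCov_posSemidef (centered : Bool) (s : Finset ℕ) (x : ℕ → Fin p → ℝ) :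
    (sampleCov centered s x).PosSemidef := by
  unfold sampleCov
  refine Matrix.PosSemidef.smul (Matrix.posSemidef_sum _ fun i _ => ?_) (by positivity)
  simpa using posSemidef_vecMulVec_self_star (x i - if centered = true
    then (s.card : ℝ)⁻¹ • ∑ i ∈ s, x i else 0)

/-- A direction orthogonal to all observations is orthogonal to their mean, so it is null for either
form of the covariance. -/
theorem sampleCov_conj_diag_eq_zero (centered : Bool) (s : Finset ℕ) {x : ℕ → Fin p → ℝ}
    (G : Matrix (Fin p) (Fin p) ℝ) {j : Fin p} (hx : ∀ i, G.col j ⬝ᵥ x i = 0) :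
    (Gᵀ * sampleCov centered s x * G) j j = 0 := by
  set c : Fin p → ℝ := if centered then (s.card : ℝ)⁻¹ • ∑ i ∈ s, x i else 0 with hc
  have hcz : G.col j ⬝ᵥ c = 0 := by
    rw [hc]
    split_ifs
    · rw [dotProduct_smul, dotProduct_sum, Finset.sum_eq_zero fun i _ => hx i, smul_zero]
    · rw [dotProduct_zero]
  have hrow (i : ℕ) : (Gᵀ *ᵥ (x i - c)) j = 0 := by
    change G.col j ⬝ᵥ (x i - c) = 0
    rw [dotProduct_sub, hx, hcz, sub_zero]
  have h1 : Gᵀ * sampleCov centered s x * G =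
      (s.card : ℝ)⁻¹ • ∑ i ∈ s, vecMulVec (Gᵀ *ᵥ (x i - c)) (Gᵀ *ᵥ (x i - c)) := by
    unfold sampleCov
    simp only [vecMulVec_rotate, Matrix.mul_smul, Matrix.smul_mul, Matrix.mul_sum, Matrix.sum_mul,
      ← hc]
  rw [h1, Matrix.smul_apply, Matrix.sum_apply]
  simp [vecMulVec_apply, hrow]

/-- Equal halves average to the whole. This generally fails after centering, which is why
linearization is done at the uncentered matrix. -/
theorem half_smul_sampleCov_add {m : ℕ} {A : Finset ℕ}
    (hA : A ⊆ Finset.range (2 * m) ∧ A.card = m) (x : ℕ → Fin p → ℝ) :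
    (2 : ℝ)⁻¹ • (sampleCov false A x + sampleCov false (Finset.range (2 * m) \ A) x) =
      sampleCov false (Finset.range (2 * m)) x := by
  have hcard : (Finset.range (2 * m) \ A).card = m := by
    rw [Finset.card_sdiff_of_subset hA.1, Finset.card_range, hA.2]; omega
  ext a b
  rw [Matrix.smul_apply, Matrix.add_apply, sampleCov_false_apply, sampleCov_false_apply,
    sampleCov_false_apply, hcard, hA.2, Finset.card_range, ← Finset.sum_sdiff hA.1]
  push_cast
  rw [mul_inv, smul_eq_mul]
  ring

end SampleCov

/-! ### Limit distribution in the i.i.d. model -/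

theorem MeasureTheory.TendstoInDistribution.comp_tendsto {Ω Ω' E : Type*} [MeasurableSpace Ω]
    [MeasurableSpace Ω'] [MeasurableSpace E] [TopologicalSpace E] [OpensMeasurableSpace E]
    {P : Measure Ω} [IsProbabilityMeasure P] {Q : Measure Ω'} [IsProbabilityMeasure Q]
    {F : ℕ → Ω → E} {Z : Ω' → E} (h : TendstoInDistribution F atTop Z (fun _ => P) Q)
    {N : ℕ → ℕ} (hN : Tendsto N atTop atTop) :
    TendstoInDistribution (fun n => F (N n)) atTop Z (fun _ => P) Q :=
  ⟨fun n => h.forall_aemeasurable (N n), h.aemeasurable_limit, h.tendsto.comp hN⟩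

section Model

variable {Ω : Type*} [MeasurableSpace Ω] {P : Measure Ω} [IsProbabilityMeasure P] {p : ℕ}

omit [IsProbabilityMeasure P] in
-- Hölder with `1/4 + 1/4 = 1/2`: fourth moments of `X` are second moments of `XXᵀ`.
theorem memLp_two_mul {X : Ω → Fin p → ℝ} (hmom : MemLp X 4 P) (a b : Fin p) :
    MemLp (fun ω => X ω a * X ω b) 2 P := by
  have : ENNReal.HolderTriple 4 4 2 := ⟨by
    rw [show (4 : ENNReal) = 2 * 2 by norm_num, ENNReal.mul_inv (by simp) (by simp), ← mul_add,
      ENNReal.inv_two_add_inv_two, mul_one]⟩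
  exact (hmom.eval b).mul (hmom.eval a)

theorem covMat_apply_of_integral_eq_zero {X : Ω → Fin p → ℝ} (hL2 : MemLp X 2 P)
    (hmean : ∫ ω, X ω ∂P = 0) (a b : Fin p) : covMat P X a b = ∫ ω, X ω a * X ω b ∂P := by
  have hz (c : Fin p) : ∫ ω, X ω c ∂P = 0 := by
    rw [← eval_integral fun c => (hL2.eval c).integrable (by norm_num), hmean]
    rfl
  simp only [covMat, of_apply, covariance, hz, sub_zero]

/-- The central limit theorem for the linearized estimator. -/
theorem betaDeriv_sampleCov_tendstoInDistribution {X : ℕ → Ω → Fin p → ℝ}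
    (hX : ∀ i, Measurable (X i)) (hindep : iIndepFun X P)
    (hident : ∀ i, IdentDistrib (X i) (X 0) P P) (hmom : MemLp (X 0) 4 P)
    (hmean : ∫ ω, X 0 ω ∂P = 0) (lam : Fin p → ℝ) (Gam : Matrix (Fin p) (Fin p) ℝ) :
    TendstoInDistribution (fun (n : ℕ) ω => √(n : ℝ) • betaDeriv (covMat P (X 0)) lam Gam
        (sampleCov false (Finset.range n) (fun i => X i ω) - covMat P (X 0)))
      atTop id (fun _ => P) (multivariateGaussian 0
        ((matH (covMat P (X 0)) lam Gam)ᵀ *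
          covMat P (fun ω => vec (vecMulVec (X 0 ω) (X 0 ω))) * matH (covMat P (X 0)) lam Gam)) := by
  set D := betaDeriv (covMat P (X 0)) lam Gam with hD
  have hvecL2 (c : Fin p × Fin p) :
      MemLp (fun ω => vec (vecMulVec (X 0 ω) (X 0 ω)) c) 2 P := memLp_two_mul hmom c.2 c.1
  have hψ : Measurable fun x : Fin p → ℝ => D (vecMulVec x x) := by
    have hD' : Continuous D := LinearMap.continuous_of_finiteDimensional D
    exact (hD'.comp (continuous_id.matrix_vecMulVec continuous_id)).measurable
  have hcoord (ω : Ω) (c) : D (vecMulVec (X 0 ω) (X 0 ω)) c =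
      ∑ a, matH (covMat P (X 0)) lam Gam a c * vec (vecMulVec (X 0 ω) (X 0 ω)) a := rfl
  have hclt := tendstoInDistribution_multivariateGaussian (P := P)
    (Z := fun i ω => D (vecMulVec (X i ω) (X i ω))) (m := D (covMat P (X 0)))
    (fun i => hψ.comp (hX i)) (hindep.comp (fun _ => fun x => D (vecMulVec x x)) fun _ => hψ)
    (fun i => (hident i).comp hψ)
    (fun c => by
      simp only [hcoord]
      exact memLp_finsetSum _ fun a _ => (hvecL2 a).const_mul _)
    (fun c => by
      simp only [hcoord]
      rw [integral_finsetSum _ fun a _ => ((hvecL2 a).integrable (by norm_num)).const_mul _]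
      simp only [integral_const_mul]
      refine Finset.sum_congr rfl fun a _ => ?_
      exact congrArg (matH (covMat P (X 0)) lam Gam a c * ·) (covMat_apply_of_integral_eq_zero (hmom.mono_exponent (by norm_num)) hmean _ _).symm)
  have hcov : covMat P (fun ω c => D (vecMulVec (X 0 ω) (X 0 ω)) c) =
      (matH (covMat P (X 0)) lam Gam)ᵀ *
        covMat P (fun ω => vec (vecMulVec (X 0 ω) (X 0 ω))) * matH (covMat P (X 0)) lam Gam :=
    covMat_transpose_mulVec hvecL2 _
  rw [hcov] at hclt
  refine hclt.congr (fun n => Eventually.of_forall fun ω => ?_) (ae_eq_refl _)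
  rcases n.eq_zero_or_pos with rfl | hn
  · simp
  have hn' : (0 : ℝ) < n := by exact_mod_cast hn
  have hS : sampleCov false (Finset.range n) (fun i => X i ω) =
      (n : ℝ)⁻¹ • ∑ i ∈ Finset.range n, vecMulVec (X i ω) (X i ω) := by
    simp [sampleCov]
  have h1 : ∑ i ∈ Finset.range n, D (vecMulVec (X i ω) (X i ω)) - (n : ℝ) • D (covMat P (X 0)) =
      (n : ℝ) • D (sampleCov false (Finset.range n) (fun i => X i ω) - covMat P (X 0)) := by
    rw [map_sub, smul_sub, hS, map_smul, smul_smul, mul_inv_cancel₀ hn'.ne', one_smul, map_sum]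
  change (√(n : ℝ))⁻¹ • (∑ i ∈ Finset.range n, D (vecMulVec (X i ω) (X i ω)) -
    (n : ℝ) • D (covMat P (X 0))) = _
  rw [h1, smul_smul]
  congr 1
  rw [inv_mul_eq_div, Real.div_sqrt]

omit [IsProbabilityMeasure P] in
theorem tendsto_measure_exists_neg {f : ℕ → Ω → Fin p → ℝ}
    (h : ∀ j, Tendsto (fun n => P {ω | f n ω j < 0}) atTop (𝓝 0)) :
    Tendsto (fun n => P {ω | ∃ j, f n ω j < 0}) atTop (𝓝 0) := by
  have h1 : Tendsto (fun n => ∑ j, P {ω | f n ω j < 0}) atTop (𝓝 0) := by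
    simpa using tendsto_finsetSum Finset.univ fun j _ => h j
  refine tendsto_of_tendsto_of_tendsto_of_le_of_le tendsto_const_nhds h1 (fun _ => zero_le)
    fun n => ?_
  have : {ω | ∃ j, f n ω j < 0} ⊆ ⋃ j ∈ (Finset.univ : Finset (Fin p)), {ω | f n ω j < 0} := by
    rintro ω ⟨j, hj⟩
    simp only [Set.mem_iUnion]
    exact ⟨j, Finset.mem_univ j, hj⟩
  exact (measure_mono this).trans (measure_biUnion_finset_le _ _)

theorem exists_measure_momentFun_ge_le {X : ℕ → Ω → Fin p → ℝ} (hindep : iIndepFun X P)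
    (hident : ∀ i, IdentDistrib (X i) (X 0) P P) (hmom : MemLp (X 0) 4 P)
    (hmean : ∫ ω, X 0 ω ∂P = 0) :
    ∃ C : ℝ, ∀ s : Finset ℕ, 0 < s.card → ∀ c : ℝ, 0 < c →
      P {ω | c ≤ sumAbsMean (momentFun (covMat P (X 0))) s fun i => X i ω} ≤
        ENNReal.ofReal (C / (s.card * c ^ 2)) := by
  have hL2 : MemLp (X 0) 2 P := hmom.mono_exponent (by norm_num)
  refine exists_measure_sumAbsMean_ge_le hindep hident ?_ ?_ ?_
  · rintro (⟨a, b⟩ | a)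
    · exact ((measurable_pi_apply a).mul (measurable_pi_apply b)).sub_const _
    · exact measurable_pi_apply a
  · rintro (⟨a, b⟩ | a)
    · exact (memLp_two_mul hmom a b).sub (memLp_const _)
    · exact hL2.eval a
  · rintro (⟨a, b⟩ | a)
    · simp only [momentFun, Sum.elim_inl]
      rw [integral_sub ((memLp_two_mul hmom a b).integrable (by norm_num)) (integrable_const _),
        covMat_apply_of_integral_eq_zero hL2 hmean]
      simp
    · simp only [momentFun, Sum.elim_inr]
      rw [← eval_integral fun c => (hL2.eval c).integrable (by norm_num), hmean]
      rfl

theorem variance_col_dotProduct {X : Ω → Fin p → ℝ} (hL2 : MemLp X 2 P)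
    {lam : Fin p → ℝ} {Gam : Matrix (Fin p) (Fin p) ℝ}
    (hdec : IsSpectralDecomp (covMat P X) lam Gam) (j : Fin p) :
    Var[fun ω => Gam.col j ⬝ᵥ X ω; P] = lam j := by
  have h1 := variance_sum_mul_eq (fun c => hL2.eval c) (Gam.col j)
  have h2 := congrFun (congrFun hdec.conj_eq j) j
  rw [diagonal_apply_eq] at h2
  rw [← h2, Matrix.mul_assoc]
  exact h1

/-- `lam j` is the variance of the centered variable `γ_jᵀX`; if it is zero the variable vanishes
almost surely, for each observation by equality of laws. This covers a singular `Σ`. -/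
theorem ae_col_dotProduct_eq_zero {X : ℕ → Ω → Fin p → ℝ}
    (hident : ∀ i, IdentDistrib (X i) (X 0) P P) (hL2 : MemLp (X 0) 2 P)
    (hmean : ∫ ω, X 0 ω ∂P = 0) {lam : Fin p → ℝ} {Gam : Matrix (Fin p) (Fin p) ℝ}
    (hdec : IsSpectralDecomp (covMat P (X 0)) lam Gam) :
    ∀ᵐ ω ∂P, ∀ j, lam j = 0 → ∀ i, Gam.col j ⬝ᵥ X i ω = 0 := by
  refine ae_all_iff.2 fun j => ?_
  by_cases hj : lam j = 0
  · have hg : Measurable fun x : Fin p → ℝ => Gam.col j ⬝ᵥ x := by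
      unfold dotProduct; fun_prop
    have hL : MemLp (fun ω => Gam.col j ⬝ᵥ X 0 ω) 2 P :=
      memLp_finsetSum _ fun c _ => (hL2.eval c).const_mul _
    have hz : ∫ ω, Gam.col j ⬝ᵥ X 0 ω ∂P = 0 := by
      simp only [dotProduct]
      rw [integral_finsetSum _ fun c _ => ((hL2.eval c).integrable (by norm_num)).const_mul _]
      refine Finset.sum_eq_zero fun c _ => ?_
      rw [integral_const_mul, ← eval_integral fun c => (hL2.eval c).integrable (by norm_num),
        hmean]
      simp
    have h0 := ae_eq_integral_of_variance_eq_zero hL (by rw [variance_col_dotProduct hL2 hdec, hj])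
    rw [hz] at h0
    have hall : ∀ᵐ ω ∂P, ∀ i, Gam.col j ⬝ᵥ X i ω = 0 := by
      refine ae_all_iff.2 fun i => ?_
      exact ((hident i).comp hg).symm.ae_snd (p := fun y => y = 0) (measurableSet_singleton 0) h0
    filter_upwards [hall] with ω hω _ using hω
  · exact Eventually.of_forall fun ω h => absurd h hj

/-- Estimators that are approximated by the linearization at the uncentered sample covariance
matrix inherit its limit distribution. -/
theorem tendstoInDistribution_of_betaVec_linearization {X : ℕ → Ω → Fin p → ℝ}
    (hX : ∀ i, Measurable (X i)) (hindep : iIndepFun X P)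
    (hident : ∀ i, IdentDistrib (X i) (X 0) P P) (hmom : MemLp (X 0) 4 P)
    (hmean : ∫ ω, X 0 ω ∂P = 0) {lam : Fin p → ℝ} {Gam : Matrix (Fin p) (Fin p) ℝ}
    {N : ℕ → ℕ} (hN : Tendsto N atTop atTop) {lh : ℕ → Ω → Fin p → ℝ}
    {Gh : ℕ → Ω → Matrix (Fin p) (Fin p) ℝ}
    (hmeas : ∀ n, AEMeasurable (fun ω => betaVec (lh n ω) (Gh n ω)) P)
    (hsign : ∀ j, Tendsto (fun n => P {ω | (Gh n ω).col j ⬝ᵥ Gam.col j < 0}) atTop (𝓝 0))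
    {ε : ℕ → Ω → ℝ} {C : ℝ}
    (hlin : ∀ η > 0, ∃ δ > 0, ∀ᶠ n in atTop, ∀ᵐ ω ∂P,
      (∀ j, 0 ≤ (Gh n ω).col j ⬝ᵥ Gam.col j) → ε n ω < δ →
      ‖betaVec (lh n ω) (Gh n ω) - betaVec lam Gam - betaDeriv (covMat P (X 0)) lam Gam
        (sampleCov false (Finset.range (N n)) (fun i => X i ω) - covMat P (X 0))‖ ≤ η * ε n ω)
    (htight : ∀ᶠ n in atTop, ∀ c > 0, P {ω | c ≤ ε n ω} ≤ ENNReal.ofReal (C / (N n * c ^ 2))) :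
    TendstoInDistribution
      (fun (n : ℕ) ω => √(N n : ℝ) • (betaVec (lh n ω) (Gh n ω) - betaVec lam Gam))
      atTop id (fun _ => P) (multivariateGaussian 0
        ((matH (covMat P (X 0)) lam Gam)ᵀ *
          covMat P (fun ω => vec (vecMulVec (X 0 ω) (X 0 ω))) * matH (covMat P (X 0)) lam Gam)) := by
  -- Slutsky: the scaled difference from the linearized statistic tends to zero in probability.
  refine tendstoInDistribution_of_tendstoInMeasure_sub _ _
    ((betaDeriv_sampleCov_tendstoInDistribution hX hindep hident hmom hmean lam Gam).comp_tendsto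
      hN) ?_ fun n => ((hmeas n).sub_const (betaVec lam Gam)).const_smul √(N n : ℝ)
  rw [tendstoInMeasure_iff_norm]
  intro κ hκ
  have hmain := tendsto_measure_of_linearization (P := P) (N := N) (ε := ε)
    (B := fun n => {ω | ∃ j, (Gh n ω).col j ⬝ᵥ Gam.col j < 0})
    (Δ := fun n ω => betaVec (lh n ω) (Gh n ω) - betaVec lam Gam -
      betaDeriv (covMat P (X 0)) lam Gam
        (sampleCov false (Finset.range (N n)) (fun i => X i ω) - covMat P (X 0)))
    (fun η hη => by
      obtain ⟨δ, hδ, h⟩ := hlin η hη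
      refine ⟨δ, hδ, h.mono fun n hn => hn.mono fun ω hω hB hε => hω (fun j => ?_) hε⟩
      by_contra hcon
      exact hB ⟨j, not_le.1 hcon⟩)
    (tendsto_measure_exists_neg (f := fun n ω j => (Gh n ω).col j ⬝ᵥ Gam.col j) hsign)
    hN htight hκ
  refine hmain.congr fun n => ?_
  congr 1
  ext ω
  simp only [Set.mem_ofPred_eq, Pi.sub_apply, Pi.zero_apply, sub_zero, smul_sub]

end Model

/-! ### The limit theorems for product-PCA and PCA -/

theorem theorem1 {Ω : Type*} [MeasurableSpace Ω] (P : Measure Ω) [IsProbabilityMeasure P]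
    (p : ℕ)
    -- i.i.d. observations with mean zero and finite fourth moments
    (X : ℕ → Ω → Fin p → ℝ) (hX : ∀ i, Measurable (X i))
    (hindep : iIndepFun X P) (hident : ∀ i, IdentDistrib (X i) (X 0) P P)
    (hmom : MemLp (X 0) 4 P) (hmean : ∫ ω, X 0 ω ∂P = 0)
    -- covariance matrix, its distinct eigenvalues in descending order, its eigenvectors
    (Sig : Matrix (Fin p) (Fin p) ℝ) (hSig : Sig = covMat P (X 0))
    (lam : Fin p → ℝ) (Gam : Matrix (Fin p) (Fin p) ℝ)
    (hdec : IsSpectralDecomp Sig lam Gam) (hlam : StrictAnti lam)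
    -- the asymptotic covariance matrix `Hᵀ W H`
    (W : Matrix (Fin p × Fin p) (Fin p × Fin p) ℝ)
    (hW : W = covMat P (fun ω => vec (vecMulVec (X 0 ω) (X 0 ω))))
    (SigBeta : Matrix (Fin p ⊕ Fin p × Fin p) (Fin p ⊕ Fin p × Fin p) ℝ)
    (hSigBeta : SigBeta = (matH Sig lam Gam)ᵀ * W * matH Sig lam Gam)
    -- either form of the sample covariance matrix
    (centered : Bool) :
    -- product-PCA, sample size `n = 2 m`
    (∀ (A : ℕ → Ω → Finset ℕ) (lhat : ℕ → Ω → Fin p → ℝ)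
        (Ghat : ℕ → Ω → Matrix (Fin p) (Fin p) ℝ),
      -- random split into two halves, independent of the data
      (∀ m, Measurable[_, ⊤] (A m)) →
      (∀ m ω, A m ω ⊆ Finset.range (2 * m) ∧ (A m ω).card = m) →
      (∀ m, Indep (MeasurableSpace.comap (A m) ⊤)
        (MeasurableSpace.comap (fun ω (i : Fin (2 * m)) => X i ω) inferInstance) P) →
      -- the estimators
      (∀ m, ∀ᵐ ω ∂P, IsPPCA
        (sampleCov centered (A m ω) (fun i => X i ω))
        (sampleCov centered (Finset.range (2 * m) \ A m ω) (fun i => X i ω))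
        (lhat m ω) (Ghat m ω)) →
      (∀ m, AEMeasurable (fun ω => betaVec (lhat m ω) (Ghat m ω)) P) →
      -- signs of the estimated eigenvectors
      (∀ j, Tendsto (fun m => P {ω | (Ghat m ω).col j ⬝ᵥ Gam.col j < 0}) atTop (𝓝 0)) →
      TendstoInDistribution
        (fun (m : ℕ) ω => √((2 * m : ℕ) : ℝ) • (betaVec (lhat m ω) (Ghat m ω) - betaVec lam Gam))
        atTop id (fun _ => P) (multivariateGaussian 0 SigBeta)) ∧
    -- ordinary PCA, sample size `n`
    (∀ (ltil : ℕ → Ω → Fin p → ℝ) (Gtil : ℕ → Ω → Matrix (Fin p) (Fin p) ℝ),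
      (∀ n, ∀ᵐ ω ∂P, IsSpectralDecomp
        (sampleCov centered (Finset.range n) (fun i => X i ω)) (ltil n ω) (Gtil n ω)) →
      (∀ n, AEMeasurable (fun ω => betaVec (ltil n ω) (Gtil n ω)) P) →
      (∀ j, Tendsto (fun n => P {ω | (Gtil n ω).col j ⬝ᵥ Gam.col j < 0}) atTop (𝓝 0)) →
      TendstoInDistribution
        (fun (n : ℕ) ω => √(n : ℝ) • (betaVec (ltil n ω) (Gtil n ω) - betaVec lam Gam))
        atTop id (fun _ => P) (multivariateGaussian 0 SigBeta)) := by
  subst hSig hW hSigBeta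
  have hL2 : MemLp (X 0) 2 P := hmom.mono_exponent (by norm_num)
  have hnn (i : Fin p) : 0 ≤ lam i := by
    rw [← variance_col_dotProduct hL2 hdec i]; exact variance_nonneg _ _
  obtain ⟨C, hC⟩ := exists_measure_momentFun_ge_le hindep hident hmom hmean
  have hφ : ∀ k, Measurable (momentFun (covMat P (X 0)) k) := by
    rintro (⟨a, b⟩ | a)
    · exact ((measurable_pi_apply a).mul (measurable_pi_apply b)).sub_const _
    · exact measurable_pi_apply a
  constructor
  · intro A lhat Ghat hA hAN hAind hppca hmeas hsign
    have hcardc (m : ℕ) {a : Finset ℕ} (ha : a ⊆ Finset.range (2 * m)) (hc : a.card = m) :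
        (Finset.range (2 * m) \ a).card = m := by
      rw [Finset.card_sdiff_of_subset ha, Finset.card_range, hc]; omega
    refine tendstoInDistribution_of_betaVec_linearization hX hindep hident hmom hmean
      (N := fun m => 2 * m) (C := 16 * C) (ε := fun m ω =>
        sumAbsMean (momentFun (covMat P (X 0))) (A m ω) (fun i => X i ω) +
        sumAbsMean (momentFun (covMat P (X 0))) (Finset.range (2 * m) \ A m ω) (fun i => X i ω))
      (tendsto_id.const_mul_atTop' two_pos) hmeas hsign (fun η hη => ?_) ?_
    · obtain ⟨δ, hδ, h⟩ := ppca_linearization hdec hlam hnn hη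
      refine ⟨δ, hδ, (eventually_gt_atTop 0).mono fun m hm => ?_⟩
      filter_upwards [hppca m, ae_col_dotProduct_eq_zero hident hL2 hmean hdec]
        with ω hω hker hs hε
      have n1 := sumAbsMean_nonneg (momentFun (covMat P (X 0))) (A m ω) fun i => X i ω
      have n2 := sumAbsMean_nonneg (momentFun (covMat P (X 0))) (Finset.range (2 * m) \ A m ω)
        fun i => X i ω
      have c1 : 0 < (A m ω).card := by rw [(hAN m ω).2]; exact hm
      have c2 : 0 < (Finset.range (2 * m) \ A m ω).card := by
        rw [hcardc m (hAN m ω).1 (hAN m ω).2]; exact hm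
      have habs := abs_of_nonneg (add_nonneg n1 n2)
      -- The mean of the two halves no longer depends on the split, so the linear term is the same
      -- as for PCA.
      rw [← half_smul_sampleCov_add (hAN m ω)]
      have := h _ _ _ _ _ _ _ (sampleCov_posSemidef centered (A m ω) fun i => X i ω)
        (sampleCov_posSemidef centered (Finset.range (2 * m) \ A m ω) fun i => X i ω)
        (fun j hj => sampleCov_conj_diag_eq_zero centered _ Gam (hker j hj))
        (fun j hj => sampleCov_conj_diag_eq_zero centered _ Gam (hker j hj)) hω hs
        (fun a b => (abs_sampleCov_false_sub_le _ c1 _ a b).trans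
          (by rw [habs]; exact le_add_of_nonneg_right n2))
        (fun a b => (abs_sampleCov_false_sub_le _ c2 _ a b).trans
          (by rw [habs]; exact le_add_of_nonneg_left n1))
        (fun a b => (abs_sampleCov_sub_le (covMat P (X 0)) centered _ _ a b).trans
          (pow_le_pow_left₀ n1 (le_add_of_nonneg_right n2) 2))
        (fun a b => (abs_sampleCov_sub_le (covMat P (X 0)) centered _ _ a b).trans
          (pow_le_pow_left₀ n2 (le_add_of_nonneg_left n1) 2)) (by rwa [habs])
      rwa [habs] at this
    · refine (eventually_gt_atTop 0).mono fun m hm c hc => ?_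
      have hm' : (0 : ℝ) < m := by exact_mod_cast hm
      have b1 := measure_sumAbsMean_random_ge_le hφ (hA m) (hAN m) (hAind m) (g := id)
        (fun a ha => ha) (c := c / 2) (b := ENNReal.ofReal (C / (m * (c / 2) ^ 2)))
        fun a _ ha => by
          have := hC a (by rw [ha]; exact hm) (c / 2) (by positivity)
          rwa [ha] at this
      have b2 := measure_sumAbsMean_random_ge_le hφ (hA m) (hAN m) (hAind m)
        (g := fun a => Finset.range (2 * m) \ a) (fun a _ => Finset.sdiff_subset) (c := c / 2)
        (b := ENNReal.ofReal (C / (m * (c / 2) ^ 2)))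
        fun a ha hc' => by
          have hk := hcardc m ha hc'
          have := hC (Finset.range (2 * m) \ a) (by rw [hk]; exact hm) (c / 2) (by positivity)
          rwa [hk] at this
      -- Each half has `m` observations and threshold `c / 2`, giving `4C / (m c²)`; the two
      -- together give `8C / (m c²) = 16C / (2m c²)`.
      have hC0 : ENNReal.ofReal (C / (m * (c / 2) ^ 2)) + ENNReal.ofReal (C / (m * (c / 2) ^ 2)) =
          ENNReal.ofReal (16 * C / ((2 * m : ℕ) * c ^ 2)) := by
        rw [← two_mul, ← ENNReal.ofReal_ofNat 2, ← ENNReal.ofReal_mul (by norm_num)]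
        congr 1
        push_cast
        field_simp
        ring
      rw [← hC0]
      refine le_trans ?_ (add_le_add b1 b2)
      refine le_trans (measure_mono fun ω hω => ?_) (measure_union_le _ _)
      by_contra hcon
      simp only [Set.mem_union, Set.mem_ofPred_eq, not_or, not_le, id] at hcon hω
      linarith [hcon.1, hcon.2]
  · intro ltil Gtil hpca hmeas hsign
    refine tendstoInDistribution_of_betaVec_linearization hX hindep hident hmom hmean
      (N := fun n => n) (C := C) (ε := fun n ω =>
        sumAbsMean (momentFun (covMat P (X 0))) (Finset.range n) (fun i => X i ω))
      tendsto_id hmeas hsign (fun η hη => ?_) ?_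
    · obtain ⟨δ, hδ, h⟩ := pca_linearization hdec hlam hη
      refine ⟨δ, hδ, (eventually_gt_atTop 0).mono fun n hn => ?_⟩
      filter_upwards [hpca n] with ω hω hs hε
      have habs := abs_of_nonneg
        (sumAbsMean_nonneg (momentFun (covMat P (X 0))) (Finset.range n) fun i => X i ω)
      have := h _ _ _ _ _ hω hs
        (fun a b => (abs_sampleCov_false_sub_le _ (by simpa using hn) _ a b).trans
          (le_abs_self _))
        (fun a b => abs_sampleCov_sub_le (covMat P (X 0)) centered _ _ a b) (by rwa [habs])
      rwa [habs] at this
    · refine (eventually_gt_atTop 0).mono fun n hn c hc => ?_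
      simpa using hC (Finset.range n) (by simpa using hn) c hc
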